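/- Work over $\mathbb{C}$. Let $E=\mathbb{C}^2$ with basis $v_1,v_2$, and let $C=E\oplus \mathrm{End}(E)\oplus E^*$ be the octonion algebra with product $$(x\oplus\xi\oplus f)\cdot(y\oplus\eta\oplus g)=(\eta x+\bar\xi y)\oplus(\overline{g\otimes x}+\xi\eta+f\otimes y)\oplus(g\xi+f\bar\eta),$$ where $\bar\xi=\mathrm{Tr}(\xi)\,\mathrm{id}-\xi$ and $g\otimes x$ is the endomorphism $w\mapsto g(w)x$. Let $G_2$ be the automorphism group of $C$ and $\mathfrak{g}_2$ its Lie algebra of derivations. Let $P\subset G_2$ be the stabilizer of the subspace $E\subset C$, with Lie algebra $\mathfrak{p}=\{D\in\mathfrak{g}_2 : D(E)\subseteq E\}$, and let $P$ act on $U=\mathfrak{g}_2/\mathfrak{p}$ by the adjoint action. For the maximal torus $T=(\mathbb{C}^*)^2$ acting diagonally on $E$ with weights $t_1,t_2$, and the simple roots $\alpha_1=t_1-t_2$, $\alpha_2=-t_1+2t_2$ ($\alpha_2$ long), $P$ is the maximal parabolic subgroup for the long root: $\mathfrak{p}$ is the sum of the $T$-weight spaces of $\mathfrak{g}_2$ for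 the weights $0$, $\alpha_1$, $\alpha_2$, $\alpha_1+\alpha_2$, $2\alpha_1+\alpha_2$, $3\alpha_1+\alpha_2$, $3\alpha_1+2\alpha_2$ and $-\alpha_1$. Sending the class of $D$ to $D|_E$ modulo $E$ identifies $U$ with the space $(\mathrm{Sym}^3E^*\otimes\bigwedge^2E)\oplus\bigwedge^2E^*$ of those linear maps $\varphi=\varphi_1\oplus\varphi_2:E\to \mathrm{End}(E)\oplus E^*$ for which the trilinear form $\Phi(x,y,w)=\varphi_1(x)(y)\wedge w$ is symmetric and the bilinear form $\varphi_2$ is alternating. Let $U'=\mathrm{Sym}^3E^*\otimes\bigwedge^2E\subset U$ be the subspace $\varphi_2=0$. Using $v_1\wedge v_2$ to identify $\bigwedge^2E$ with $\mathbb{C}$, let $a=\Phi(v_1,v_2,v_2)$, $b=\Phi(v_2,v_2,v_2)$, $c=-\Phi(v_1,v_1,v_1)$, $d=-\Phi(v_1,v_1,v_2)$ be coordinates on $U'$, so that the binary cubic form $\Phi(v,v,v)$, $v=xv_1+yv_2$, is $-cx^3-3dx^2y+3axy^2+by^3$. **Proposition.** There are exactly five $P$-orbits $O_0,O_1,O_2,O_3,O_5$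 in $U$, where $O_i$ has codimension $i$. Their Zariski closures are strictly nested, $\overline{O_0}\supsetneq\overline{O_1}\supsetneq\overline{O_2}\supsetneq\overline{O_3}\supsetneq\overline{O_5}$, and are as follows. * $\overline{O_0}=U$. * $\overline{O_1}=U'$. * $\overline{O_2}$ is the discriminant locus in $U'$: the set of $u\in U'$ whose cubic form can be written $\ell^2m$ with linear forms $\ell,m$ on $E$. It is defined in $U'$ by the vanishing of $q(3a,b,c,3d)$, where $$q(A,b,c,D)=A^2D^2+4A^3c+4bD^3-27b^2c^2+18AbcD$$ is the discriminant of the cubic $-cx^3-Dx^2y+Axy^2+by^3$. * $\overline{O_3}$ is the affine cone $\{(b,a,-d,-c)=r\,(s^3,s^2t,st^2,t^3) : r,s,t\in\mathbb{C}\}\subset U'$ over the twisted cubic curve in $\mathbb{P}(U')=\mathbb{P}^3$. It is defined in $U'$ by the condition that the matrix $$\begin{pmatrix} a&-d&c\\ b&a&d\end{pmatrix}$$ has rank at most $1$. * $\overline{O_5}=O_5=\{0\}$. -/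

import Mathlib

open scoped Matrix

namespace TrialityG2

/-- The standard two-dimensional complex vector space, with basis `v₁, v₂`. -/
abbrev E : Type := Fin 2 → ℂ

/-- The dual of `E`, in coordinates (row vectors). -/
abbrev EDual : Type := Fin 2 → ℂ

/-- `End(E)`, as 2 × 2 matrices. -/
abbrev EndE : Type := Matrix (Fin 2) (Fin 2) ℂ

/-- The underlying space of the octonion algebra `C = E ⊕ End(E) ⊕ E*`; its elements are
written `x ⊕ ξ ⊕ f`. -/
@[ext] structure Oct where
  /-- the component in `E` -/
  x : E
  /-- the component in `End(E)` -/
  ξ : EndE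
  /-- the component in `E*` -/
  f : EDual

namespace Oct

/-- `C` as a product; its vector space structure is the componentwise one. -/
def equivProd : Oct ≃ E × EndE × EDual where
  toFun u := (u.x, u.ξ, u.f)
  invFun t := ⟨t.1, t.2.1, t.2.2⟩
  left_inv _ := rfl
  right_inv _ := rfl

noncomputable instance : AddCommGroup Oct := equivProd.addCommGroup

noncomputable instance : Module ℂ Oct := equivProd.module ℂ

instance : Module.Finite ℂ Oct := Module.Finite.equiv (equivProd.linearEquiv ℂ).symm

@[simp] lemma x_zero : (0 : Oct).x = 0 := rfl
@[simp] lemma ξ_zero : (0 : Oct).ξ = 0 := rfl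
@[simp] lemma f_zero : (0 : Oct).f = 0 := rfl
@[simp] lemma x_add (u v : Oct) : (u + v).x = u.x + v.x := rfl
@[simp] lemma ξ_add (u v : Oct) : (u + v).ξ = u.ξ + v.ξ := rfl
@[simp] lemma f_add (u v : Oct) : (u + v).f = u.f + v.f := rfl
@[simp] lemma x_smul (r : ℂ) (u : Oct) : (r • u).x = r • u.x := rfl
@[simp] lemma ξ_smul (r : ℂ) (u : Oct) : (r • u).ξ = r • u.ξ := rfl
@[simp] lemma f_smul (r : ℂ) (u : Oct) : (r • u).f = r • u.f := rfl

end Oct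

/-- Conjugation `ξ ↦ Tr(ξ) e - ξ` on `End(E)`. -/
def conjEnd (ξ : EndE) : EndE := ξ.trace • (1 : EndE) - ξ

/-- The octonion product
`(x ⊕ ξ ⊕ f)(y ⊕ η ⊕ g) = (η x + ξ̄ y) ⊕ (conj(g ⊗ x) + ξ η + f ⊗ y) ⊕ (g ξ + f η̄)`,
where `g ⊗ x` is the endomorphism `w ↦ g(w) x`. -/
def octMul (u v : Oct) : Oct where
  x := v.ξ *ᵥ u.x + conjEnd u.ξ *ᵥ v.x
  ξ := conjEnd (Matrix.vecMulVec u.x v.f) + u.ξ * v.ξ + Matrix.vecMulVec v.x u.f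
  f := v.f ᵥ* u.ξ + u.f ᵥ* conjEnd v.ξ

lemma conjEnd_add (ξ η : EndE) : conjEnd (ξ + η) = conjEnd ξ + conjEnd η := by
  simp only [conjEnd, Matrix.trace_add, add_smul]; abel

lemma conjEnd_smul (r : ℂ) (ξ : EndE) : conjEnd (r • ξ) = r • conjEnd ξ := by
  simp [conjEnd, smul_sub, smul_smul]

lemma octMul_add_left (u u' v : Oct) : octMul (u + u') v = octMul u v + octMul u' v := by
  apply Oct.ext <;>
  simp only [octMul, Oct.x_add, Oct.ξ_add, Oct.f_add, conjEnd_add, Matrix.mulVec_add,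
    Matrix.add_mulVec, Matrix.add_mul, Matrix.add_vecMulVec, Matrix.vecMulVec_add,
    Matrix.vecMul_add, Matrix.add_vecMul] <;> abel

lemma octMul_add_right (u v v' : Oct) : octMul u (v + v') = octMul u v + octMul u v' := by
  apply Oct.ext <;>
  simp only [octMul, Oct.x_add, Oct.ξ_add, Oct.f_add, conjEnd_add, Matrix.mulVec_add,
    Matrix.add_mulVec, Matrix.mul_add, Matrix.add_vecMulVec, Matrix.vecMulVec_add,
    Matrix.vecMul_add, Matrix.add_vecMul] <;> abel

lemma octMul_smul_left (r : ℂ) (u v : Oct) : octMul (r • u) v = r • octMul u v := by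
  apply Oct.ext <;>
  simp only [octMul, Oct.x_smul, Oct.ξ_smul, Oct.f_smul, conjEnd_smul, Matrix.mulVec_smul,
    Matrix.smul_mulVec, Matrix.smul_vecMulVec, Matrix.vecMulVec_smul, Matrix.vecMul_smul,
    Matrix.smul_vecMul, Matrix.smul_mul, smul_add]

lemma octMul_smul_right (r : ℂ) (u v : Oct) : octMul u (r • v) = r • octMul u v := by
  apply Oct.ext <;>
  simp only [octMul, Oct.x_smul, Oct.ξ_smul, Oct.f_smul, conjEnd_smul, Matrix.mulVec_smul,
    Matrix.smul_mulVec, Matrix.smul_vecMulVec, Matrix.vecMulVec_smul, Matrix.vecMul_smul,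
    Matrix.smul_vecMul, Matrix.mul_smul, smul_add]

/-- The group `G₂`: linear automorphisms of `C` preserving the octonion product. -/
def G2 : Subgroup (Oct ≃ₗ[ℂ] Oct) where
  carrier := {g | ∀ u v, g (octMul u v) = octMul (g u) (g v)}
  one_mem' _ _ := rfl
  mul_mem' {g h} hg hh u v := by
    simp only [Set.mem_ofPred_eq] at hg hh
    simp only [LinearEquiv.mul_apply, hh, hg]
  inv_mem' {g} hg u v := by
    simp only [Set.mem_ofPred_eq] at hg
    apply g.injective
    rw [hg]
    change g (g.symm _) = octMul (g (g.symm _)) (g (g.symm _))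
    simp

/-- The Lie algebra `𝔤₂` of `G₂`: the derivations of the octonion product. Only its vector
space structure and the adjoint action are needed below. -/
def g2 : Submodule ℂ (Oct →ₗ[ℂ] Oct) where
  carrier := {D | ∀ u v, D (octMul u v) = octMul (D u) v + octMul u (D v)}
  zero_mem' u v := by
    have h1 : octMul 0 v = 0 := by simpa using octMul_smul_left 0 0 v
    have h2 : octMul u 0 = 0 := by simpa using octMul_smul_right 0 u 0
    simp [h1, h2]
  add_mem' {D D'} hD hD' u v := by
    simp only [Set.mem_ofPred_eq] at hD hD'
    simp only [LinearMap.add_apply, hD, hD', octMul_add_left, octMul_add_right]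
    abel
  smul_mem' r D hD u v := by
    simp only [Set.mem_ofPred_eq] at hD
    simp only [LinearMap.smul_apply, hD, octMul_smul_left, octMul_smul_right, smul_add]

/-- The subspace `E = E ⊕ 0 ⊕ 0` of `C`, a two-dimensional `G₂`-isotropic subspace. -/
def subE : Submodule ℂ Oct where
  carrier := {u | u.ξ = 0 ∧ u.f = 0}
  zero_mem' := ⟨rfl, rfl⟩
  add_mem' {u v} hu hv := ⟨by simp [hu.1, hv.1], by simp [hu.2, hv.2]⟩
  smul_mem' r u hu := ⟨by simp [hu.1], by simp [hu.2]⟩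

/-- The parabolic subgroup `P ⊂ G₂`: the stabilizer of the point `[E]` of the
Grassmannian of isotropic planes, which is `G₂/P`. -/
def P : Subgroup G2 where
  carrier := {g | subE.map (g : Oct ≃ₗ[ℂ] Oct).toLinearMap = subE}
  one_mem' := Submodule.map_id subE
  mul_mem' {g h} hg hh := by
    simp only [Set.mem_ofPred_eq] at hg hh ⊢
    have : ((g * h : G2) : Oct ≃ₗ[ℂ] Oct).toLinearMap =
        (g : Oct ≃ₗ[ℂ] Oct).toLinearMap ∘ₗ (h : Oct ≃ₗ[ℂ] Oct).toLinearMap := rfl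
    rw [this, Submodule.map_comp, hh, hg]
  inv_mem' {g} hg := by
    simp only [Set.mem_ofPred_eq] at hg ⊢
    have h : ((g⁻¹ : G2) : Oct ≃ₗ[ℂ] Oct).toLinearMap ∘ₗ (g : Oct ≃ₗ[ℂ] Oct).toLinearMap =
        LinearMap.id := by
      refine LinearMap.ext fun u => ?_
      exact (g : Oct ≃ₗ[ℂ] Oct).symm_apply_apply u
    conv_lhs => rw [← hg]
    rw [← Submodule.map_comp, h, Submodule.map_id]

/-- The Lie algebra `𝔭` of `P`: derivations of `C` that map `E` into itself. -/
def p : Submodule ℂ g2 where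
  carrier := {D | ∀ u ∈ subE, (D : Oct →ₗ[ℂ] Oct) u ∈ subE}
  zero_mem' u _ := by simp
  add_mem' {D D'} hD hD' u hu := by
    simpa using subE.add_mem (hD u hu) (hD' u hu)
  smul_mem' r D hD u hu := by
    simpa using subE.smul_mem r (hD u hu)

/-- The `P`-module `U = 𝔤₂/𝔭`. -/
abbrev U : Type := g2 ⧸ p

/-- The adjoint representation of `G₂` on `𝔤₂`, `Ad(g) D = g D g⁻¹`. -/
noncomputable def Ad : Representation ℂ G2 g2 where
  toFun g :=
    { toFun := fun D => ⟨(g : Oct ≃ₗ[ℂ] Oct).conj (D : Oct →ₗ[ℂ] Oct), by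
        intro u v
        have hg : ∀ u v, (g : Oct ≃ₗ[ℂ] Oct) (octMul u v) =
          octMul ((g : Oct ≃ₗ[ℂ] Oct) u) ((g : Oct ≃ₗ[ℂ] Oct) v) := g.2
        have hg' : ∀ u v, (g : Oct ≃ₗ[ℂ] Oct).symm (octMul u v) =
          octMul ((g : Oct ≃ₗ[ℂ] Oct).symm u) ((g : Oct ≃ₗ[ℂ] Oct).symm v) := (g⁻¹).2
        have hD : ∀ u v, (D : Oct →ₗ[ℂ] Oct) (octMul u v) =
          octMul ((D : Oct →ₗ[ℂ] Oct) u) v + octMul u ((D : Oct →ₗ[ℂ] Oct) v) := D.2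
        simp [LinearEquiv.conj_apply, hg, hg', hD]⟩
      map_add' := fun D D' => Subtype.ext (by simp)
      map_smul' := fun r D => Subtype.ext (by simp) }
  map_one' := by
    ext1 D
    exact Subtype.ext rfl
  map_mul' g h := by
    ext1 D
    exact Subtype.ext rfl

lemma Ad_mem_p (g : P) (D : g2) (hD : D ∈ p) : Ad g D ∈ p := by
  intro u hu
  have h1 : subE.map ((g : G2) : Oct ≃ₗ[ℂ] Oct).toLinearMap = subE := g.2
  have h2 : subE.map (((g⁻¹ : P) : G2) : Oct ≃ₗ[ℂ] Oct).toLinearMap = subE := (g⁻¹).2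
  have h3 : ((g : G2) : Oct ≃ₗ[ℂ] Oct).symm u ∈ subE := by
    rw [← h2]; exact ⟨u, hu, rfl⟩
  change ((g : G2) : Oct ≃ₗ[ℂ] Oct)
    ((D : Oct →ₗ[ℂ] Oct) (((g : G2) : Oct ≃ₗ[ℂ] Oct).symm u)) ∈ subE
  rw [← h1]
  exact ⟨_, hD _ h3, rfl⟩

/-- The adjoint action of `P` on `U = 𝔤₂/𝔭`. -/
noncomputable def AdU : Representation ℂ P U where
  toFun g := p.mapQ p (Ad g) (fun D hD => Ad_mem_p g D hD)
  map_one' := by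
    ext D
    simp
  map_mul' g h := by
    ext D
    simp

/-- The `P`-orbit of `u` in `U`. -/
def orbit (u : U) : Set U := Set.range fun g : P => AdU g u

/-- The set of all `P`-orbits in `U`. -/
def orbits : Set (Set U) := Set.range orbit

/-- The action on `C` of the element of the torus `T = (ℂ*)²` with coordinates `(z₁, z₂)`,
induced from the diagonal action on `E`. -/
def torus (z : Fin 2 → ℂˣ) (u : Oct) : Oct where
  x i := z i * u.x i
  ξ := Matrix.of fun i j => (z i : ℂ) * u.ξ i j * ((z j)⁻¹ : ℂˣ)
  f i := u.f i * ((z i)⁻¹ : ℂˣ)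

/-- The `T`-weight space in `𝔤₂` for the weight `k α₁ + l α₂`, where `α₁ = t₁ - t₂` and
`α₂ = -t₁ + 2 t₂` (the long one) are the simple roots; as a character of `T` this weight is
`z₁ ^ (k - l) * z₂ ^ (2 l - k)`. -/
def weightSpace (k l : ℤ) : Submodule ℂ g2 where
  carrier := {D | ∀ (z : Fin 2 → ℂˣ) (u : Oct),
    torus z ((D : Oct →ₗ[ℂ] Oct) u) =
      ((z 0 : ℂ) ^ (k - l) * (z 1 : ℂ) ^ (2 * l - k)) •
        (D : Oct →ₗ[ℂ] Oct) (torus z u)}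
  zero_mem' z u := by
    ext <;> simp [torus]
  add_mem' {D D'} hD hD' z u := by
    have h : ∀ a b, torus z (a + b) = torus z a + torus z b := by
      intro a b
      ext <;> simp [torus] <;> ring
    simp only [Submodule.coe_add, LinearMap.add_apply, h, hD z u, hD' z u, smul_add]
  smul_mem' r D hD z u := by
    have h : ∀ a, torus z (r • a) = r • torus z a := by
      intro a
      ext <;> simp [torus] <;> ring
    simp only [Submodule.coe_smul, LinearMap.smul_apply, h, hD z u]
    rw [smul_comm]

/-- The identification of `U = 𝔤₂/𝔭` with a space of linear maps
`E → C/E = End(E) ⊕ E*`, as the tangent space to `G₂/P` at `[E]` inside the tangent space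
`Hom(E, C/E)` of the Grassmannian of planes in `C`: the class of `D` goes to the
restriction of `D` to `E`, taken modulo `E`. -/
noncomputable def phi : U →ₗ[ℂ] (E →ₗ[ℂ] EndE × EDual) :=
  p.liftQ
    { toFun := fun D =>
        { toFun := fun x => (((D : Oct →ₗ[ℂ] Oct) ⟨x, 0, 0⟩).ξ, ((D : Oct →ₗ[ℂ] Oct) ⟨x, 0, 0⟩).f)
          map_add' := fun x y => by
            have h : (⟨x + y, 0, 0⟩ : Oct) = ⟨x, 0, 0⟩ + ⟨y, 0, 0⟩ := by ext <;> simp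
            simp [h]
          map_smul' := fun r x => by
            have h : (⟨r • x, 0, 0⟩ : Oct) = r • ⟨x, 0, 0⟩ := by ext <;> simp
            simp [h] }
      map_add' := fun _ _ => rfl
      map_smul' := fun _ _ => rfl }
    (fun D hD => by
      rw [LinearMap.mem_ker]
      refine LinearMap.ext fun x => ?_
      have h := hD ⟨x, 0, 0⟩ ⟨rfl, rfl⟩
      exact Prod.ext h.1 h.2)

/-- The trilinear form `(x, y, w) ↦ φ₁(x)(y) ∧ w`, with values in `⋀² E ≅ ℂ` (the isomorphism
sends `v₁ ∧ v₂` to `1`), of a map `φ = φ₁ ⊕ φ₂ : E → End(E) ⊕ E*`. -/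
def trilinear (φ : E →ₗ[ℂ] EndE × EDual) (x y w : E) : ℂ :=
  ((φ x).1 *ᵥ y) 0 * w 1 - ((φ x).1 *ᵥ y) 1 * w 0

/-- Triality-symmetric maps `φ = φ₁ ⊕ φ₂`: the trilinear form of `φ₁` is symmetric and the
bilinear form `φ₂` is alternating, that is, `φ ∈ (Sym³ E* ⊗ ⋀² E) ⊕ ⋀² E*`. -/
def IsTrialitySymmetric (φ : E →ₗ[ℂ] EndE × EDual) : Prop :=
  (∀ x y w, trilinear φ x y w = trilinear φ y x w) ∧
  (∀ x y w, trilinear φ x y w = trilinear φ x w y) ∧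
  ∀ x, (φ x).2 ⬝ᵥ x = 0

/-- The submodule `U' = Sym³ E* ⊗ ⋀² E` of `U`, given by `φ₂ = 0`. -/
noncomputable def U' : Submodule ℂ U where
  carrier := {u | ∀ x, (phi u x).2 = 0}
  zero_mem' x := by simp
  add_mem' {u v} hu hv x := by
    simp only [Set.mem_ofPred_eq] at hu hv
    simp [hu, hv]
  smul_mem' r u hu x := by
    simp only [Set.mem_ofPred_eq] at hu
    simp [hu]

/-- The cubic form on `E` of an element of `U`. -/
noncomputable def cubicForm (u : U) (x : E) : ℂ := trilinear (phi u) x x x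

/-- The coordinate `a = Φ(v₁,v₂,v₂)` of `u`, where `Φ` is the trilinear form of `u`. -/
noncomputable def ca (u : U) : ℂ := trilinear (phi u) ![1, 0] ![0, 1] ![0, 1]
/-- The coordinate `b = Φ(v₂,v₂,v₂)`. -/
noncomputable def cb (u : U) : ℂ := trilinear (phi u) ![0, 1] ![0, 1] ![0, 1]
/-- The coordinate `c = -Φ(v₁,v₁,v₁)`. -/
noncomputable def cc (u : U) : ℂ := -trilinear (phi u) ![1, 0] ![1, 0] ![1, 0]
/-- The coordinate `d = -Φ(v₁,v₁,v₂)`. -/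
noncomputable def cd (u : U) : ℂ := -trilinear (phi u) ![1, 0] ![1, 0] ![0, 1]

/-- The discriminant of the binary cubic `-c x³ - d x² y + a x y² + b y³`. -/
def discQuartic (a b c d : ℂ) : ℂ :=
  a ^ 2 * d ^ 2 + 4 * a ^ 3 * c + 4 * b * d ^ 3 - 27 * b ^ 2 * c ^ 2 + 18 * a * b * c * d

section Zariski

variable {V : Type*} [AddCommGroup V] [Module ℂ V] [Module.Finite ℂ V]

/-- The ideal of a subset `S` of a finite-dimensional vector space `V`, in the ring of
polynomial functions on `V` (written in linear coordinates). -/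
noncomputable def idealOf (S : Set V) :
    Ideal (MvPolynomial (Fin (Module.finrank ℂ V)) ℂ) :=
  MvPolynomial.vanishingIdeal ℂ ((Module.finBasis ℂ V).equivFun '' S)

/-- The closure of `S` in the Zariski topology on `V`. -/
noncomputable def zariskiClosure (S : Set V) : Set V :=
  (Module.finBasis ℂ V).equivFun ⁻¹' MvPolynomial.zeroLocus ℂ (idealOf S)

/-- The codimension in `V` of (the Zariski closure of) `S`: the height of its ideal. -/
noncomputable def codim (S : Set V) : ℕ∞ := (idealOf S).height

end Zariski

end TrialityG2

open TrialityG2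

/-! Give `E*`, `End(E)`, `E` the degrees -1, 0, 1. Then `𝔤₂` contains explicit derivations of
degrees -2, ..., 2: cubics in degrees ±1, alternating forms in degrees ±2 and `𝔤𝔩(E)` in degree 0. A
derivation killing `E` is a sum of pieces of degrees 1 and 2 (`eq_upper_of_basisE`), so `𝔭` is
exactly the part of nonnegative degree. Conversely `E · E = 0`, and the Leibniz rule applied to this
relation forces `φ = D|_E` modulo `E` to be triality-symmetric. The derivations of negative degree
realize every such `φ`, hence `U` has coordinates `a, b, c, d` of a cubic and `e` of an alternating
form.

The subspace `e = 0` is stable under `P`, and there `g` acts only through its matrix `A` on `E`, by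
substitution with a twist by `det A` (`AdU_of_mem_U'`). All of `GL(E)` occurs, and over `ℂ` a binary
cubic splits into linear forms, so the orbits in `U'` are given by the root pattern: distinct roots,
one double root, a triple root, zero. Each normal form is reached by a substitution whose
determinant absorbs the twist. Where `e ≠ 0`, a unipotent element removes the cubic and an element
of `GL(E)` normalizes `e` to 1 (`generic_subset_orbit`).

For closures and codimensions, every orbit is a member of `flag` or the difference of two members.
The members are closed because they have equations (`doubleRoot_eq_disc`, `tripleRoot_eq_minors`)
and irreducible because they are images of polynomial maps, so removing a proper closed part does
not change the ideal (`idealOf_diff`). The auxiliary line `cubeLine` completes the closures to a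
chain of six irreducible closed sets in a space of dimension five. The heights of their ideals must
then be 0, ..., 5 (`codim_of_flag`). -/

namespace TrialityG2

/-! ### Polynomial maps, Zariski closures and codimension -/

section PolyMap

variable {V : Type*} [AddCommGroup V] [Module ℂ V]

/-- Polynomial maps from `ℂᵏ` to a vector space. -/
def IsPolyMap {k : ℕ} (F : (Fin k → ℂ) → V) : Prop :=
  ∀ l : V →ₗ[ℂ] ℂ, ∃ q : MvPolynomial (Fin k) ℂ, ∀ y, l (F y) = MvPolynomial.aeval y q

/-- It suffices to check polynomiality of a map in one system of linear coordinates. -/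
lemma IsPolyMap.of_coords {k n : ℕ} {F : (Fin k → ℂ) → V} (e : V ≃ₗ[ℂ] (Fin n → ℂ))
    (q : Fin n → MvPolynomial (Fin k) ℂ)
    (h : ∀ y i, e (F y) i = MvPolynomial.aeval y (q i)) : IsPolyMap F := by
  intro l
  refine ⟨∑ i, MvPolynomial.C (l (e.symm (Pi.single i 1))) * q i, fun y => ?_⟩
  have h1 : F y = ∑ i, e (F y) i • e.symm (Pi.single i 1) := by
    apply e.injective
    simp only [map_sum, map_smul, LinearEquiv.apply_symm_apply]
    exact pi_eq_sum_univ' _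
  conv_lhs => rw [h1]
  simp only [map_sum, map_smul, map_mul, smul_eq_mul, h]
  exact Finset.sum_congr rfl fun i _ => by simp [mul_comm]

end PolyMap

section Zariski

variable {V : Type*} [AddCommGroup V] [Module ℂ V] [Module.Finite ℂ V]

lemma mem_idealOf {S : Set V} {q : MvPolynomial (Fin (Module.finrank ℂ V)) ℂ} :
    q ∈ idealOf S ↔ ∀ v ∈ S, MvPolynomial.aeval ((Module.finBasis ℂ V).equivFun v) q = 0 := by
  simp only [idealOf, MvPolynomial.mem_vanishingIdeal_iff, Set.forall_mem_image]

lemma mem_zariskiClosure {S : Set V} {v : V} :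
    v ∈ zariskiClosure S ↔
      ∀ q ∈ idealOf S, MvPolynomial.aeval ((Module.finBasis ℂ V).equivFun v) q = 0 := Iff.rfl

lemma subset_zariskiClosure (S : Set V) : S ⊆ zariskiClosure S :=
  fun _ hv _ hq => mem_idealOf.1 hq _ hv

lemma idealOf_anti {S T : Set V} (h : S ⊆ T) : idealOf T ≤ idealOf S :=
  fun _ hq => mem_idealOf.2 fun v hv => mem_idealOf.1 hq v (h hv)

lemma zariskiClosure_eq_of_idealOf_eq {S T : Set V} (h : idealOf S = idealOf T) :
    zariskiClosure S = zariskiClosure T := by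
  simp only [zariskiClosure, h]

/-- Subsets that are closed in the Zariski topology. -/
def IsZariskiClosed (S : Set V) : Prop := zariskiClosure S = S

lemma IsZariskiClosed.inter {S T : Set V} (hS : IsZariskiClosed S) (hT : IsZariskiClosed T) :
    IsZariskiClosed (S ∩ T) := by
  refine Set.Subset.antisymm (fun v hv => ⟨?_, ?_⟩) (subset_zariskiClosure _)
  · rw [← hS]
    exact fun q hq => hv q (idealOf_anti Set.inter_subset_left hq)
  · rw [← hT]
    exact fun q hq => hv q (idealOf_anti Set.inter_subset_right hq)

/-- Polynomial functions on a finite-dimensional vector space. -/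
def IsPolyFun (f : V → ℂ) : Prop :=
  ∃ q : MvPolynomial (Fin (Module.finrank ℂ V)) ℂ,
    ∀ v, f v = MvPolynomial.aeval ((Module.finBasis ℂ V).equivFun v) q

namespace IsPolyFun

lemma const (r : ℂ) : IsPolyFun fun _ : V => r := ⟨MvPolynomial.C r, fun v => by simp⟩

lemma add {f g : V → ℂ} (hf : IsPolyFun f) (hg : IsPolyFun g) :
    IsPolyFun fun v => f v + g v := by
  obtain ⟨q, hq⟩ := hf
  obtain ⟨r, hr⟩ := hg
  exact ⟨q + r, fun v => by simp only [map_add, hq, hr]⟩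

lemma mul {f g : V → ℂ} (hf : IsPolyFun f) (hg : IsPolyFun g) :
    IsPolyFun fun v => f v * g v := by
  obtain ⟨q, hq⟩ := hf
  obtain ⟨r, hr⟩ := hg
  exact ⟨q * r, fun v => by simp only [map_mul, hq, hr]⟩

lemma neg {f : V → ℂ} (hf : IsPolyFun f) : IsPolyFun fun v => -f v := by
  obtain ⟨q, hq⟩ := hf
  exact ⟨-q, fun v => by simp only [map_neg, hq]⟩

lemma sub {f g : V → ℂ} (hf : IsPolyFun f) (hg : IsPolyFun g) :
    IsPolyFun fun v => f v - g v := by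
  simpa only [sub_eq_add_neg] using hf.add hg.neg

lemma pow {f : V → ℂ} (hf : IsPolyFun f) (n : ℕ) : IsPolyFun fun v => f v ^ n := by
  obtain ⟨q, hq⟩ := hf
  exact ⟨q ^ n, fun v => by simp only [map_pow, hq]⟩

lemma sum {ι : Type*} (s : Finset ι) {f : ι → V → ℂ} (hf : ∀ i, IsPolyFun (f i)) :
    IsPolyFun fun v => ∑ i ∈ s, f i v := by
  choose q hq using hf
  exact ⟨∑ i ∈ s, q i, fun v => by simp only [map_sum, hq]⟩

lemma linear (l : V →ₗ[ℂ] ℂ) : IsPolyFun fun v => l v := by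
  have h : ∀ v, l v =
      ∑ i, (Module.finBasis ℂ V).equivFun v i * l (Module.finBasis ℂ V i) := by
    intro v
    conv_lhs => rw [← (Module.finBasis ℂ V).sum_equivFun v]
    simp only [map_sum, map_smul, smul_eq_mul]
  rw [show (fun v => l v) = _ from funext h]
  exact sum _ fun i => (show IsPolyFun _ from ⟨MvPolynomial.X i, fun v => by simp⟩).mul (const _)

lemma isZariskiClosed {f : V → ℂ} (hf : IsPolyFun f) : IsZariskiClosed {v | f v = 0} := by
  obtain ⟨q, hq⟩ := hf
  refine Set.Subset.antisymm (fun v hv => ?_) (subset_zariskiClosure _)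
  rw [Set.mem_ofPred_eq, hq]
  exact hv q (mem_idealOf.2 fun w hw => by rw [← hq]; exact hw)

end IsPolyFun

/-- The image of a polynomial map from `ℂᵏ` is irreducible. -/
lemma IsPolyMap.idealOf_isPrime {k : ℕ} {F : (Fin k → ℂ) → V} (hF : IsPolyMap F) :
    (idealOf (Set.range F)).IsPrime := by
  choose q hq using fun i => hF
    (LinearMap.proj i ∘ₗ (Module.finBasis ℂ V).equivFun.toLinearMap)
  -- A polynomial vanishes on the image iff its pullback along `F` is the zero polynomial, `ℂ` being
  -- infinite. The ideal is thus a kernel of a homomorphism into a domain.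
  have h : idealOf (Set.range F) = RingHom.ker (MvPolynomial.aeval q :
      MvPolynomial (Fin (Module.finrank ℂ V)) ℂ →ₐ[ℂ] MvPolynomial (Fin k) ℂ) := by
    ext r
    have h1 : ∀ y, MvPolynomial.aeval ((Module.finBasis ℂ V).equivFun (F y)) r =
        MvPolynomial.aeval y (MvPolynomial.aeval q r) := by
      intro y
      have h2 : (Module.finBasis ℂ V).equivFun (F y) =
          fun i => MvPolynomial.aeval y (q i) := funext fun i => hq i y
      rw [h2, ← MvPolynomial.comp_aeval_apply]
    simp only [mem_idealOf, Set.forall_mem_range, h1, RingHom.mem_ker]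
    refine ⟨fun h => ?_, fun h y => by rw [h, map_zero]⟩
    refine MvPolynomial.funext fun y => ?_
    simpa [MvPolynomial.aeval_eq_eval] using h y
  rw [h]
  exact RingHom.ker_isPrime _

/-- Removing a closed subset from an irreducible set does not change the ideal. -/
lemma idealOf_diff {S T : Set V} (hS : (idealOf S).IsPrime) (hT : IsZariskiClosed T)
    (h : ¬S ⊆ T) : idealOf (S \ T) = idealOf S := by
  refine le_antisymm (fun q hq => ?_) (idealOf_anti Set.sdiff_subset)
  obtain ⟨v, hvS, hvT⟩ := Set.not_subset.1 h
  rw [← hT, mem_zariskiClosure] at hvT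
  push Not at hvT
  obtain ⟨r, hr, hrv⟩ := hvT
  -- Here `r` vanishes on `T` but not at `v ∈ S`, so the product with `q` vanishes on all of `S`,
  -- and primality removes the factor `r`.
  have h1 : q * r ∈ idealOf S := by
    refine mem_idealOf.2 fun w hw => ?_
    rw [map_mul]
    by_cases hwT : w ∈ T
    · rw [mem_idealOf.1 hr w hwT, mul_zero]
    · rw [mem_idealOf.1 hq w ⟨hw, hwT⟩, zero_mul]
  exact (hS.mem_or_mem h1).resolve_right fun h2 => hrv (mem_idealOf.1 h2 v hvS)

/-- A closed set is recovered from its ideal, so equal ideals would put `S` inside `T`. Only the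
smaller set has to be closed. -/
lemma idealOf_lt {S T : Set V} (hT : IsZariskiClosed T) (h : T ⊂ S) :
    idealOf S < idealOf T := by
  refine lt_of_le_of_ne (idealOf_anti h.1) fun h1 => h.2 ?_
  rw [← hT, ← zariskiClosure_eq_of_idealOf_eq h1]
  exact subset_zariskiClosure S

/-- In a full flag of irreducible closed subsets, the codimensions are the expected ones. -/
lemma codim_of_flag {n : ℕ} (hn : Module.finrank ℂ V = n) (X : ℕ → Set V)
    (hX : ∀ i ≤ n, (idealOf (X i)).IsPrime) (hc : ∀ i ≤ n, IsZariskiClosed (X i))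
    (hlt : ∀ i < n, X (i + 1) ⊂ X i) (i : ℕ) (hi : i ≤ n) : codim (X i) = i := by
  have hstep : ∀ i < n, codim (X i) + 1 ≤ codim (X (i + 1)) := by
    intro i hi
    have := hX i hi.le
    have := hX (i + 1) hi
    exact Ideal.height_add_one_le_of_lt_of_isPrime (idealOf_lt (hc _ hi) (hlt i hi))
  have hge : ∀ i ≤ n, (i : ℕ∞) ≤ codim (X i) := by
    intro i
    induction i with
    | zero => intro _; simp
    | succ i ih =>
      intro hi
      calc ((i + 1 : ℕ) : ℕ∞) = i + 1 := by simp
        _ ≤ codim (X i) + 1 := by gcongr; exact ih (by omega)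
        _ ≤ _ := hstep i hi
  -- No height exceeds the Krull dimension `n` of the polynomial ring, so the last of `n` strict
  -- steps leaves no slack; descending from the end bounds every height above.
  have htop : codim (X n) ≤ n := by
    have h1 := Ideal.height_le_ringKrullDim_of_ne_top (hX n le_rfl).ne_top
    rw [MvPolynomial.ringKrullDim_of_isNoetherianRing, ringKrullDim_eq_zero_of_field, zero_add,
      Nat.card_fin] at h1
    have h2 : codim (X n) ≤ (Module.finrank ℂ V : ℕ) := by exact_mod_cast h1
    exact h2.trans_eq (by rw [hn])
  have hle : ∀ j i, i + j = n → codim (X i) ≤ i := by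
    intro j
    induction j with
    | zero => rintro i rfl; exact htop
    | succ j ih =>
      intro i hi
      have h1 := (hstep i (by omega)).trans (ih (i + 1) (by omega))
      rw [Nat.cast_add, Nat.cast_one] at h1
      exact (ENat.add_le_add_iff_right ENat.one_ne_top).1 h1
  exact le_antisymm (hle (n - i) i (by omega)) (hge i hi)

end Zariski

/-! ### The product in coordinates and the homogeneous derivations -/

lemma Oct.ext_coords {u v : Oct} (h1 : ∀ i, u.x i = v.x i) (h2 : ∀ i j, u.ξ i j = v.ξ i j)
    (h3 : ∀ i, u.f i = v.f i) : u = v :=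
  Oct.ext (funext h1) (Matrix.ext h2) (funext h3)

lemma octMul_x (u v : Oct) (i : Fin 2) : (octMul u v).x i =
    v.ξ i 0 * u.x 0 + v.ξ i 1 * u.x 1 + (u.ξ 0 0 + u.ξ 1 1) * v.x i -
      (u.ξ i 0 * v.x 0 + u.ξ i 1 * v.x 1) := by
  have h : conjEnd u.ξ *ᵥ v.x = (u.ξ 0 0 + u.ξ 1 1) • v.x - u.ξ *ᵥ v.x := by
    simp [conjEnd, Matrix.sub_mulVec, Matrix.smul_mulVec, Matrix.trace_fin_two]
  simp only [octMul, h, Pi.add_apply, Pi.sub_apply, Pi.smul_apply, smul_eq_mul, Matrix.mulVec,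
    dotProduct, Fin.sum_univ_two]
  ring

lemma octMul_ξ (u v : Oct) (i j : Fin 2) : (octMul u v).ξ i j =
    (u.x 0 * v.f 0 + u.x 1 * v.f 1) * (1 : EndE) i j - u.x i * v.f j +
      (u.ξ i 0 * v.ξ 0 j + u.ξ i 1 * v.ξ 1 j) + v.x i * u.f j := by
  simp [octMul, conjEnd, Matrix.mul_apply, Fin.sum_univ_two, Matrix.trace, Matrix.vecMulVec_apply]

lemma octMul_f (u v : Oct) (j : Fin 2) : (octMul u v).f j =
    v.f 0 * u.ξ 0 j + v.f 1 * u.ξ 1 j + u.f j * (v.ξ 0 0 + v.ξ 1 1) -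
      (u.f 0 * v.ξ 0 j + u.f 1 * v.ξ 1 j) := by
  have h : u.f ᵥ* conjEnd v.ξ = (v.ξ 0 0 + v.ξ 1 1) • u.f - u.f ᵥ* v.ξ := by
    simp [conjEnd, Matrix.vecMul_sub, Matrix.vecMul_smul, Matrix.trace_fin_two]
  simp only [octMul, h, Pi.add_apply, Pi.sub_apply, Pi.smul_apply, smul_eq_mul, Matrix.vecMul,
    dotProduct, Fin.sum_univ_two]
  ring

/-- The map `x ↦ φ(x)` from `E` to `End(E)` attached to the binary cubic with symmetric tensor
coordinates `q 0, …, q 3`: `φ(x)(y) ∧ w` is the polarization of the cubic. -/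
def cubicEnd (q : Fin 4 → ℂ) (x : E) : EndE :=
  !![x 0 * q 1 + x 1 * q 2, x 0 * q 2 + x 1 * q 3;
    -(x 0 * q 0 + x 1 * q 1), -(x 0 * q 1 + x 1 * q 2)]

/-- The derivation of degree `0` given by `A ∈ 𝔤𝔩(E)`. -/
def leviDer (A : EndE) : g2 where
  val :=
    { toFun := fun u => ⟨A *ᵥ u.x, A * u.ξ - u.ξ * A, -(u.f ᵥ* A)⟩
      map_add' := fun u v => by
        apply Oct.ext <;> simp [Matrix.mulVec_add, mul_add, add_mul, Matrix.add_vecMul] <;> abel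
      map_smul' := fun r u => by
        apply Oct.ext <;>
          simp [Matrix.mulVec_smul, Matrix.smul_vecMul, smul_sub] }
  property u v := by
    apply Oct.ext_coords <;>
      simp only [Oct.x_add, Oct.ξ_add, Oct.f_add, Pi.add_apply, Matrix.add_apply, octMul_x,
        octMul_ξ, octMul_f, LinearMap.coe_mk, AddHom.coe_mk, Matrix.mulVec, Matrix.vecMul,
        dotProduct, Fin.sum_univ_two, Matrix.sub_apply, Matrix.mul_apply, Pi.neg_apply,
        Fin.forall_fin_two, Matrix.one_fin_two, Matrix.of_apply,
        Matrix.cons_val_zero, Matrix.cons_val_one] <;>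
      (refine ⟨?_, ?_⟩ <;> try refine ⟨?_, ?_⟩) <;> ring

/-- The derivation of degree `-1` given by a binary cubic. -/
def lowerCubic (q : Fin 4 → ℂ) : g2 where
  val :=
    { toFun := fun u => ⟨0, cubicEnd q u.x, fun k =>
        -∑ i, ∑ j, u.ξ i j * cubicEnd q (Pi.single i 1) j k⟩
      map_add' := fun u v => by
        apply Oct.ext_coords <;>
          simp [cubicEnd, Fin.forall_fin_two, Fin.sum_univ_two] <;>
          (refine ⟨?_, ?_⟩ <;> try refine ⟨?_, ?_⟩) <;> ring
      map_smul' := fun r u => by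
        apply Oct.ext_coords <;>
          simp [cubicEnd, Fin.forall_fin_two, Fin.sum_univ_two] <;>
          (refine ⟨?_, ?_⟩ <;> try refine ⟨?_, ?_⟩) <;> ring }
  property u v := by
    apply Oct.ext_coords <;>
      simp [octMul_x, octMul_ξ, octMul_f, cubicEnd, Fin.forall_fin_two, Fin.sum_univ_two] <;>
      (refine ⟨?_, ?_⟩ <;> try refine ⟨?_, ?_⟩) <;> ring

/-- The derivation of degree `1` given by a binary cubic on `E*`. -/
def upperCubic (q : Fin 4 → ℂ) : g2 where
  val :=
    { toFun := fun u => ⟨fun k =>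
        -∑ i, ∑ j, u.ξ i j * cubicEnd q (Pi.single j 1) i k, (cubicEnd q u.f)ᵀ, 0⟩
      map_add' := fun u v => by
        apply Oct.ext_coords <;>
          simp [cubicEnd, Fin.forall_fin_two, Fin.sum_univ_two] <;>
          (refine ⟨?_, ?_⟩ <;> try refine ⟨?_, ?_⟩) <;> ring
      map_smul' := fun r u => by
        apply Oct.ext_coords <;>
          simp [cubicEnd, Fin.forall_fin_two, Fin.sum_univ_two] <;>
          (refine ⟨?_, ?_⟩ <;> try refine ⟨?_, ?_⟩) <;> ring }
  property u v := by
    apply Oct.ext_coords <;>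
      simp [octMul_x, octMul_ξ, octMul_f, cubicEnd, Fin.forall_fin_two, Fin.sum_univ_two] <;>
      (refine ⟨?_, ?_⟩ <;> try refine ⟨?_, ?_⟩) <;> ring

/-- The derivation of degree `-2` given by an alternating bilinear form on `E`. -/
def lowerAlt (e : ℂ) : g2 where
  val :=
    { toFun := fun u => ⟨0, 0, ![-e * u.x 1, e * u.x 0]⟩
      map_add' := fun u v => by
        apply Oct.ext_coords <;> simp [Fin.forall_fin_two]; constructor <;> ring
      map_smul' := fun r u => by
        apply Oct.ext_coords <;> simp [Fin.forall_fin_two]; constructor <;> ring }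
  property u v := by
    apply Oct.ext_coords <;>
      simp [octMul_x, octMul_ξ, octMul_f, Fin.forall_fin_two] <;>
      (refine ⟨?_, ?_⟩ <;> try refine ⟨?_, ?_⟩) <;> ring

/-- The derivation of degree `2` given by an alternating bilinear form on `E*`. -/
def upperAlt (e : ℂ) : g2 where
  val :=
    { toFun := fun u => ⟨![-e * u.f 1, e * u.f 0], 0, 0⟩
      map_add' := fun u v => by
        apply Oct.ext_coords <;> simp [Fin.forall_fin_two]; constructor <;> ring
      map_smul' := fun r u => by
        apply Oct.ext_coords <;> simp [Fin.forall_fin_two]; constructor <;> ring }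
  property u v := by
    apply Oct.ext_coords <;>
      simp [octMul_x, octMul_ξ, octMul_f, Fin.forall_fin_two] <;>
      (refine ⟨?_, ?_⟩ <;> try refine ⟨?_, ?_⟩) <;> ring

/-! ### Generators of the octonions and the weight decomposition of `𝔭` -/

/-- The basis vector `v_i` of `E ⊂ C`. -/
def basisE (i : Fin 2) : Oct := ⟨Pi.single i 1, 0, 0⟩

/-- The dual basis vectors of `E* ⊂ C`. -/
def basisF (i : Fin 2) : Oct := ⟨0, 0, Pi.single i 1⟩

@[simp] lemma Oct.x_sub (u v : Oct) : (u - v).x = u.x - v.x := rfl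
@[simp] lemma Oct.ξ_sub (u v : Oct) : (u - v).ξ = u.ξ - v.ξ := rfl
@[simp] lemma Oct.f_sub (u v : Oct) : (u - v).f = u.f - v.f := rfl
@[simp] lemma basisE_x (i : Fin 2) : (basisE i).x = Pi.single i 1 := rfl
@[simp] lemma basisE_ξ (i : Fin 2) : (basisE i).ξ = 0 := rfl
@[simp] lemma basisE_f (i : Fin 2) : (basisE i).f = 0 := rfl
@[simp] lemma basisF_x (i : Fin 2) : (basisF i).x = 0 := rfl
@[simp] lemma basisF_ξ (i : Fin 2) : (basisF i).ξ = 0 := rfl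
@[simp] lemma basisF_f (i : Fin 2) : (basisF i).f = Pi.single i 1 := rfl

lemma leviDer_x (A : EndE) (u : Oct) (i : Fin 2) :
    ((leviDer A : Oct →ₗ[ℂ] Oct) u).x i = A i 0 * u.x 0 + A i 1 * u.x 1 := by
  fin_cases i <;> simp [leviDer]

lemma leviDer_ξ (A : EndE) (u : Oct) (i j : Fin 2) :
    ((leviDer A : Oct →ₗ[ℂ] Oct) u).ξ i j = A i 0 * u.ξ 0 j + A i 1 * u.ξ 1 j -
      (u.ξ i 0 * A 0 j + u.ξ i 1 * A 1 j) := by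
  simp [leviDer, Matrix.mul_apply]

lemma leviDer_f (A : EndE) (u : Oct) (j : Fin 2) :
    ((leviDer A : Oct →ₗ[ℂ] Oct) u).f j = -(u.f 0 * A 0 j + u.f 1 * A 1 j) := by
  simp [leviDer, Matrix.vecMul, dotProduct]

lemma upperCubic_x (q : Fin 4 → ℂ) (u : Oct) (k : Fin 2) :
    ((upperCubic q : Oct →ₗ[ℂ] Oct) u).x k =
      -∑ i, ∑ j, u.ξ i j * cubicEnd q (Pi.single j 1) i k := rfl

lemma upperCubic_ξ (q : Fin 4 → ℂ) (u : Oct) :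
    ((upperCubic q : Oct →ₗ[ℂ] Oct) u).ξ = (cubicEnd q u.f)ᵀ := rfl

lemma upperCubic_f (q : Fin 4 → ℂ) (u : Oct) : ((upperCubic q : Oct →ₗ[ℂ] Oct) u).f = 0 := rfl

lemma upperAlt_x_zero (e : ℂ) (u : Oct) :
    ((upperAlt e : Oct →ₗ[ℂ] Oct) u).x 0 = -e * u.f 1 := rfl

lemma upperAlt_x_one (e : ℂ) (u : Oct) :
    ((upperAlt e : Oct →ₗ[ℂ] Oct) u).x 1 = e * u.f 0 := rfl

lemma upperAlt_ξ (e : ℂ) (u : Oct) : ((upperAlt e : Oct →ₗ[ℂ] Oct) u).ξ = 0 := rfl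

lemma upperAlt_f (e : ℂ) (u : Oct) : ((upperAlt e : Oct →ₗ[ℂ] Oct) u).f = 0 := rfl

lemma g2_leibniz (D : g2) (u v : Oct) : (D : Oct →ₗ[ℂ] Oct) (octMul u v) =
    octMul ((D : Oct →ₗ[ℂ] Oct) u) v + octMul u ((D : Oct →ₗ[ℂ] Oct) v) := D.2 u v

/-- `E` and `E*` generate the octonion algebra. -/
lemma Oct.eq_sum (u : Oct) : u = ∑ i, u.x i • basisE i + ∑ i, u.f i • basisF i +
    ∑ i, ∑ j, u.ξ i j • octMul (basisF j) (basisE i) := by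
  apply Oct.ext_coords <;>
    simp [octMul_x, octMul_ξ, octMul_f, Fin.forall_fin_two, Fin.sum_univ_two, basisE, basisF]

/-- The `End(E)` part is spanned by products of the generators in `E*` and `E`, on which the Leibniz
rule fixes the value. -/
lemma g2_ext {D D' : g2}
    (hE : ∀ i, (D : Oct →ₗ[ℂ] Oct) (basisE i) = (D' : Oct →ₗ[ℂ] Oct) (basisE i))
    (hF : ∀ i, (D : Oct →ₗ[ℂ] Oct) (basisF i) = (D' : Oct →ₗ[ℂ] Oct) (basisF i)) : D = D' := by
  refine Subtype.ext (LinearMap.ext fun u => ?_)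
  rw [Oct.eq_sum u]
  simp only [map_add, map_sum, map_smul, g2_leibniz, hE, hF]

lemma octMul_zero_left (u : Oct) : octMul 0 u = 0 := by simpa using octMul_smul_left 0 0 u

lemma octMul_zero_right (u : Oct) : octMul u 0 = 0 := by simpa using octMul_smul_right 0 u 0

lemma octMul_one_left (u : Oct) : octMul ⟨0, 1, 0⟩ u = u := by
  apply Oct.ext_coords <;> simp [octMul_x, octMul_ξ, octMul_f, Fin.forall_fin_two]
  constructor <;> ring

lemma octMul_one_right (u : Oct) : octMul u ⟨0, 1, 0⟩ = u := by
  apply Oct.ext_coords <;> simp [octMul_x, octMul_ξ, octMul_f, Fin.forall_fin_two]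
  constructor <;> ring

lemma g2_one (D : g2) : (D : Oct →ₗ[ℂ] Oct) ⟨0, 1, 0⟩ = 0 := by
  have h := g2_leibniz D ⟨0, 1, 0⟩ ⟨0, 1, 0⟩
  simpa [octMul_one_left, octMul_one_right] using h

/-- A derivation vanishing on `E` is a sum of derivations of degrees `1` and `2`. -/
lemma eq_upper_of_basisE {D : g2} (hD : ∀ i, (D : Oct →ₗ[ℂ] Oct) (basisE i) = 0) :
    ∃ q e, D = upperCubic q + upperAlt e := by
  -- Write `f_j` for the dual basis. Applying `D` to `v_i f_j + f_j v_i = δ_ij · 1`, with `D 1 = 0`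
  -- and `D v_i = 0`, and to `f_i f_j = 0` gives linear equations that cut `D f_0`, `D f_1` down to
  -- five free parameters.
  have h1 : ∀ i j, octMul (basisE i) ((D : Oct →ₗ[ℂ] Oct) (basisF j)) +
      octMul ((D : Oct →ₗ[ℂ] Oct) (basisF j)) (basisE i) = 0 := by
    intro i j
    have h2 : octMul (basisE i) (basisF j) + octMul (basisF j) (basisE i) =
        (1 : EndE) i j • ⟨0, 1, 0⟩ := by
      apply Oct.ext_coords <;>
        fin_cases i <;> fin_cases j <;>
        simp [octMul_x, octMul_ξ, octMul_f, basisE, basisF]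
    have h3 := congrArg (D : Oct →ₗ[ℂ] Oct) h2
    simpa [g2_leibniz, hD, g2_one, octMul_zero_left, octMul_zero_right] using h3
  have h2 : ∀ i j, octMul ((D : Oct →ₗ[ℂ] Oct) (basisF i)) (basisF j) +
      octMul (basisF i) ((D : Oct →ₗ[ℂ] Oct) (basisF j)) = 0 := by
    intro i j
    rw [← g2_leibniz]
    have h2 : octMul (basisF i) (basisF j) = 0 := by
      apply Oct.ext_coords <;> simp [octMul_x, octMul_ξ, octMul_f, basisF]
    rw [h2, map_zero]
  rcases hF0 : (D : Oct →ₗ[ℂ] Oct) (basisF 0) with ⟨y, η, g⟩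
  rcases hF1 : (D : Oct →ₗ[ℂ] Oct) (basisF 1) with ⟨y', η', g'⟩
  have a1 := h1 0 0
  have a2 := h1 0 1
  have a3 := h1 1 0
  have a4 := h1 1 1
  have b1 := h2 0 0
  have b2 := h2 0 1
  have b3 := h2 1 1
  simp only [hF0, hF1] at a1 a2 a3 a4 b1 b2 b3
  simp only [Oct.ext_iff, funext_iff, ← Matrix.ext_iff, Fin.forall_fin_two, Oct.x_add,
    Oct.ξ_add, Oct.f_add, Pi.add_apply, Matrix.add_apply, octMul_x, octMul_ξ, octMul_f, basisE,
    basisF, Oct.x_zero, Oct.ξ_zero, Oct.f_zero, Pi.zero_apply, Matrix.zero_apply,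
    Matrix.one_fin_two, Matrix.of_apply, Matrix.cons_val_zero, Matrix.cons_val_one,
    Pi.single_eq_same, Pi.single_apply] at a1 a2 a3 a4 b1 b2 b3
  simp at a1 a2 a3 a4 b1 b2 b3
  -- The parameters are read off from the `End(E)` components of `D f_0`, `D f_1` and from the `v_2`
  -- coefficient of `D f_0`.
  refine ⟨![-η 0 1, η 0 0, η 1 0, η' 1 0], y 1, g2_ext (fun i => ?_) fun i => ?_⟩
  · rw [hD]
    apply Oct.ext_coords <;>
      simp [upperCubic, upperAlt, basisE, cubicEnd]
  · clear h1 h2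
    fin_cases i
    · simp only [Fin.zero_eta, hF0]
      apply Oct.ext_coords <;>
        simp [upperCubic, upperAlt, basisF, cubicEnd, Fin.forall_fin_two] <;> grind
    · simp only [Fin.mk_one, hF1]
      apply Oct.ext_coords <;>
        simp [upperCubic, upperAlt, basisF, cubicEnd, Fin.forall_fin_two] <;> grind

lemma mem_p_iff {D : g2} : D ∈ p ↔ ∀ i,
    ((D : Oct →ₗ[ℂ] Oct) (basisE i)).ξ = 0 ∧ ((D : Oct →ₗ[ℂ] Oct) (basisE i)).f = 0 := by
  refine ⟨fun h i => h (basisE i) ⟨rfl, rfl⟩, fun h u hu => ?_⟩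
  have hu' : u = ∑ i, u.x i • basisE i := by
    conv_lhs => rw [Oct.eq_sum u]
    simp [hu.1, hu.2]
  rw [hu', map_sum]
  exact subE.sum_mem fun i _ => by
    rw [map_smul]
    exact subE.smul_mem _ (h i)

/-- The weights of `𝔤₂ ⊂ End(C)` with nonnegative coefficient of `α₂` are weights of `𝔭`. -/
lemma weightSpace_le_p (k : ℤ) (l : ℕ) : weightSpace k l ≤ p := by
  intro D hD u hu
  -- The torus element `(2, 2)` acts on `E`, `End(E)`, `E*` by 2, 1, 1/2, and the weight has value
  -- `2 ^ l` there. So `D u` is an eigenvector for `2 ^ (l + 1)`, which is neither 1 nor 1/2 when `l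
  -- ≥ 0`.
  have h := hD (fun _ => Units.mk0 2 two_ne_zero) u
  have h1 : torus (fun _ => Units.mk0 2 two_ne_zero) u = (2 : ℂ) • u := by
    apply Oct.ext_coords <;> simp [torus, hu.1, hu.2]
  have h2 : (2 : ℂ) ^ (k - l) * 2 ^ (2 * (l : ℤ) - k) = 2 ^ l := by
    rw [← zpow_add₀ two_ne_zero, ← zpow_natCast]
    congr 1
    ring
  simp only [Units.val_mk0, h2, h1, map_smul, smul_smul, ← pow_succ] at h
  have h3 : (2 : ℂ) ^ (l + 1) ≠ 1 := by
    have : (1 : ℕ) < 2 ^ (l + 1) := Nat.one_lt_two_pow (by omega)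
    exact_mod_cast this.ne'
  have h4 : (2 : ℂ) ^ (l + 1) ≠ 2⁻¹ := by
    intro h5
    have h6 : (2 : ℂ) ^ (l + 2) = 1 := by rw [pow_succ, h5]; norm_num
    have : (1 : ℕ) < 2 ^ (l + 2) := Nat.one_lt_two_pow (by omega)
    exact this.ne' (by exact_mod_cast h6)
  refine ⟨?_, ?_⟩
  · ext i j
    have h5 := congrFun (congrFun (congrArg Oct.ξ h) i) j
    simp only [torus, Matrix.of_apply, Units.val_inv_eq_inv_val, Units.val_mk0, Oct.ξ_smul,
      Matrix.smul_apply, smul_eq_mul] at h5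
    have h6 : ((2 : ℂ) ^ (l + 1) - 1) * ((D : Oct →ₗ[ℂ] Oct) u).ξ i j = 0 := by
      rw [sub_mul, ← h5]; ring
    exact (mul_eq_zero.1 h6).resolve_left (sub_ne_zero.2 h3)
  · ext i
    have h5 := congrFun (congrArg Oct.f h) i
    simp only [torus, Units.val_inv_eq_inv_val, Units.val_mk0, Oct.f_smul, Pi.smul_apply,
      smul_eq_mul] at h5
    have h6 : ((2 : ℂ) ^ (l + 1) - 2⁻¹) * ((D : Oct →ₗ[ℂ] Oct) u).f i = 0 := by
      rw [sub_mul, ← h5]; ring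
    exact (mul_eq_zero.1 h6).resolve_left (sub_ne_zero.2 h4)

lemma leviDer_diagonal_mem (a d : ℂ) : leviDer !![a, 0; 0, d] ∈ weightSpace 0 0 := by
  intro z u
  have h0 := (z 0).ne_zero
  have h1 := (z 1).ne_zero
  apply Oct.ext_coords <;>
    simp [torus, leviDer_x, leviDer_ξ, leviDer_f, Fin.forall_fin_two] <;>
    (refine ⟨?_, ?_⟩ <;> try refine ⟨?_, ?_⟩) <;> field_simp

lemma leviDer_raise_mem (a : ℂ) : leviDer !![0, a; 0, 0] ∈ weightSpace 1 0 := by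
  intro z u
  have h0 := (z 0).ne_zero
  have h1 := (z 1).ne_zero
  apply Oct.ext_coords <;>
    simp [torus, leviDer_x, leviDer_ξ, leviDer_f, Fin.forall_fin_two] <;> field_simp
  simp

lemma leviDer_lower_mem (a : ℂ) : leviDer !![0, 0; a, 0] ∈ weightSpace (-1) 0 := by
  intro z u
  have h0 := (z 0).ne_zero
  have h1 := (z 1).ne_zero
  apply Oct.ext_coords <;>
    simp [torus, leviDer_x, leviDer_ξ, leviDer_f, Fin.forall_fin_two] <;> field_simp
  simp

lemma upperAlt_mem (e : ℂ) : upperAlt e ∈ weightSpace 3 2 := by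
  intro z u
  have h0 := (z 0).ne_zero
  have h1 := (z 1).ne_zero
  apply Oct.ext_coords <;>
    simp [torus, upperAlt, Fin.forall_fin_two]; field_simp; simp

lemma upperCubic_mem_three_one (q : ℂ) : upperCubic ![q, 0, 0, 0] ∈ weightSpace 3 1 := by
  intro z u
  have h0 := (z 0).ne_zero
  have h1 := (z 1).ne_zero
  apply Oct.ext_coords <;>
    simp [torus, upperCubic, cubicEnd, Fin.forall_fin_two, Fin.sum_univ_two] <;>
    field_simp

lemma upperCubic_mem_two_one (q : ℂ) : upperCubic ![0, q, 0, 0] ∈ weightSpace 2 1 := by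
  intro z u
  have h0 := (z 0).ne_zero
  have h1 := (z 1).ne_zero
  apply Oct.ext_coords <;>
    simp [torus, upperCubic, cubicEnd, Fin.forall_fin_two, Fin.sum_univ_two] <;>
    field_simp <;> simp

lemma upperCubic_mem_one_one (q : ℂ) : upperCubic ![0, 0, q, 0] ∈ weightSpace 1 1 := by
  intro z u
  have h0 := (z 0).ne_zero
  have h1 := (z 1).ne_zero
  apply Oct.ext_coords <;>
    simp [torus, upperCubic, cubicEnd, Fin.forall_fin_two, Fin.sum_univ_two] <;>
    field_simp <;> simp

lemma upperCubic_mem_zero_one (q : ℂ) : upperCubic ![0, 0, 0, q] ∈ weightSpace 0 1 := by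
  intro z u
  have h0 := (z 0).ne_zero
  have h1 := (z 1).ne_zero
  apply Oct.ext_coords <;>
    simp [torus, upperCubic, cubicEnd, Fin.forall_fin_two, Fin.sum_univ_two] <;>
    field_simp

/-- Subtracting the degree 0 derivation with the same matrix on `E` leaves a derivation that kills
`E`, to which `eq_upper_of_basisE` applies. -/
lemma eq_sum_of_mem_p {D : g2} (hD : D ∈ p) : ∃ (A : EndE) (q : Fin 4 → ℂ) (e : ℂ),
    D = leviDer A + (upperCubic q + upperAlt e) := by
  rw [mem_p_iff] at hD
  obtain ⟨q, e, h⟩ := eq_upper_of_basisE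
    (D := D - leviDer (Matrix.of fun i j => ((D : Oct →ₗ[ℂ] Oct) (basisE j)).x i)) (fun j => by
      have h1 := (hD j).1
      have h2 := (hD j).2
      fin_cases j <;> apply Oct.ext_coords <;> simp at h1 h2 <;>
        simp [leviDer_x, leviDer_ξ, leviDer_f, h1, h2])
  exact ⟨_, q, e, by rw [← h]; abel⟩

lemma p_eq_sup_weightSpace : p =
    weightSpace 0 0 ⊔ weightSpace 1 0 ⊔ weightSpace 0 1 ⊔ weightSpace 1 1 ⊔ weightSpace 2 1 ⊔
      weightSpace 3 1 ⊔ weightSpace 3 2 ⊔ weightSpace (-1) 0 := by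
  refine le_antisymm (fun D hD => ?_) ?_
  · obtain ⟨A, q, e, rfl⟩ := eq_sum_of_mem_p hD
    have h : leviDer A + (upperCubic q + upperAlt e) =
        leviDer (!![A 0 0, 0; 0, A 1 1]) + leviDer !![0, A 0 1; 0, 0] +
          upperCubic ![0, 0, 0, q 3] + upperCubic ![0, 0, q 2, 0] + upperCubic ![0, q 1, 0, 0] +
          upperCubic ![q 0, 0, 0, 0] + upperAlt e + leviDer !![0, 0; A 1 0, 0] := by
      refine g2_ext (fun i => ?_) fun i => ?_ <;> fin_cases i <;> apply Oct.ext_coords <;>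
        simp [leviDer_x, leviDer_ξ, leviDer_f, upperCubic_x, upperCubic_ξ, upperCubic_f,
          upperAlt_x_zero, upperAlt_x_one, upperAlt_ξ, upperAlt_f, cubicEnd,
          Fin.forall_fin_two]
    rw [h]
    have key : ∀ {S T : Submodule ℂ g2} {x y : g2}, x ∈ S → y ∈ T → x + y ∈ S ⊔ T :=
      fun hx hy => Submodule.add_mem_sup hx hy
    exact key (key (key (key (key (key (key (leviDer_diagonal_mem _ _) (leviDer_raise_mem _))
      (upperCubic_mem_zero_one _)) (upperCubic_mem_one_one _)) (upperCubic_mem_two_one _))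
      (upperCubic_mem_three_one _)) (upperAlt_mem _)) (leviDer_lower_mem _)
  · simp only [sup_le_iff]
    exact ⟨⟨⟨⟨⟨⟨⟨weightSpace_le_p 0 0, weightSpace_le_p 1 0⟩, weightSpace_le_p 0 1⟩,
      weightSpace_le_p 1 1⟩, weightSpace_le_p 2 1⟩, weightSpace_le_p 3 1⟩,
      weightSpace_le_p 3 2⟩, weightSpace_le_p (-1) 0⟩

/-! ### `U` as the space of triality-symmetric maps, and its coordinates -/

lemma phi_mk (D : g2) (x : E) : phi (p.mkQ D) x =
    (((D : Oct →ₗ[ℂ] Oct) ⟨x, 0, 0⟩).ξ, ((D : Oct →ₗ[ℂ] Oct) ⟨x, 0, 0⟩).f) := rfl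

lemma phi_injective : Function.Injective phi := by
  refine (injective_iff_map_eq_zero phi).2 fun u hu => ?_
  obtain ⟨D, rfl⟩ := p.mkQ_surjective u
  rw [Submodule.mkQ_apply, Submodule.Quotient.mk_eq_zero, mem_p_iff]
  intro i
  have h := LinearMap.congr_fun hu (Pi.single i 1)
  rw [phi_mk] at h
  exact ⟨congrArg Prod.fst h, congrArg Prod.snd h⟩

/-- Since `E · E = 0`, the Leibniz rule gives `(D x) y + x (D y) = 0`. The `E` component with `y =
x` makes `φ₁(x)` traceless, which is the symmetry of `Φ` in its last two arguments. The `E`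
component for general `y` then gives symmetry in the first two, and the diagonal of the `End(E)`
component with `y = x` makes `φ₂` alternating. -/
lemma isTrialitySymmetric_phi (u : U) : IsTrialitySymmetric (phi u) := by
  obtain ⟨D, rfl⟩ := p.mkQ_surjective u
  have h1 : ∀ x y : E, octMul ((D : Oct →ₗ[ℂ] Oct) ⟨x, 0, 0⟩) ⟨y, 0, 0⟩ +
      octMul ⟨x, 0, 0⟩ ((D : Oct →ₗ[ℂ] Oct) ⟨y, 0, 0⟩) = 0 := by
    intro x y
    rw [← g2_leibniz]
    have h : octMul ⟨x, 0, 0⟩ ⟨y, 0, 0⟩ = 0 := by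
      apply Oct.ext_coords <;> simp [octMul_x, octMul_ξ, octMul_f]
    rw [h, map_zero]
  have hx : ∀ x y i, (octMul ((D : Oct →ₗ[ℂ] Oct) ⟨x, 0, 0⟩) ⟨y, 0, 0⟩ +
      octMul ⟨x, 0, 0⟩ ((D : Oct →ₗ[ℂ] Oct) ⟨y, 0, 0⟩)).x i = 0 :=
    fun x y i => by rw [h1]; rfl
  have hξ : ∀ x y i, (octMul ((D : Oct →ₗ[ℂ] Oct) ⟨x, 0, 0⟩) ⟨y, 0, 0⟩ +
      octMul ⟨x, 0, 0⟩ ((D : Oct →ₗ[ℂ] Oct) ⟨y, 0, 0⟩)).ξ i i = 0 :=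
    fun x y i => by rw [h1]; rfl
  simp only [Oct.x_add, Oct.ξ_add, Pi.add_apply, Matrix.add_apply, octMul_x, octMul_ξ] at hx hξ
  have htr : ∀ x : E, ((D : Oct →ₗ[ℂ] Oct) ⟨x, 0, 0⟩).ξ 0 0 +
      ((D : Oct →ₗ[ℂ] Oct) ⟨x, 0, 0⟩).ξ 1 1 = 0 := by
    intro x
    by_cases h : x = 0
    · have h2 : (⟨x, 0, 0⟩ : Oct) = 0 := by rw [h]; rfl
      simp [h2]
    · obtain ⟨i, hi⟩ := Function.ne_iff.1 h
      have h2 := hx x x i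
      simp only [Matrix.zero_apply] at h2
      refine (mul_eq_zero.1 ?_).resolve_right hi
      linear_combination h2
  have hsymm : ∀ x y i, ((D : Oct →ₗ[ℂ] Oct) ⟨x, 0, 0⟩).ξ i 0 * y 0 +
      ((D : Oct →ₗ[ℂ] Oct) ⟨x, 0, 0⟩).ξ i 1 * y 1 =
      ((D : Oct →ₗ[ℂ] Oct) ⟨y, 0, 0⟩).ξ i 0 * x 0 +
      ((D : Oct →ₗ[ℂ] Oct) ⟨y, 0, 0⟩).ξ i 1 * x 1 := by
    intro x y i
    have h2 := hx x y i
    simp only [Matrix.zero_apply] at h2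
    linear_combination -h2 + htr x * y i
  refine ⟨fun x y w => ?_, fun x y w => ?_, fun x => ?_⟩
  · simp only [trilinear, phi_mk, Matrix.mulVec, dotProduct, Fin.sum_univ_two]
    linear_combination hsymm x y 0 * w 1 - hsymm x y 1 * w 0
  · simp only [trilinear, phi_mk, Matrix.mulVec, dotProduct, Fin.sum_univ_two]
    linear_combination (y 0 * w 1 - y 1 * w 0) * htr x
  · simp only [phi_mk, dotProduct, Fin.sum_univ_two]
    have h2 := hξ x x 0
    have h3 := hξ x x 1
    simp only [Matrix.zero_apply, Matrix.one_apply_eq, Pi.zero_apply] at h2 h3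
    linear_combination (h2 + h3) / 2

/-- Five numbers determine a triality-symmetric map. This yields the surjectivity half of
`range_phi` and the coordinates on `U`. -/
lemma IsTrialitySymmetric.apply_eq {φ : E →ₗ[ℂ] EndE × EDual} (h : IsTrialitySymmetric φ)
    (x : E) : φ x = (cubicEnd ![trilinear φ ![1, 0] ![1, 0] ![1, 0],
      trilinear φ ![1, 0] ![1, 0] ![0, 1], trilinear φ ![1, 0] ![0, 1] ![0, 1],
      trilinear φ ![0, 1] ![0, 1] ![0, 1]] x,
      ![-(φ ![1, 0]).2 1 * x 1, (φ ![1, 0]).2 1 * x 0]) := by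
  obtain ⟨h1, h2, h3⟩ := h
  have hx : x = x 0 • ![1, 0] + x 1 • ![0, 1] := by
    ext i
    fin_cases i <;> simp
  have hφ : φ x = x 0 • φ ![1, 0] + x 1 • φ ![0, 1] := by
    conv_lhs => rw [hx]
    simp only [map_add, map_smul]
  have a1 := h1 ![1, 0] ![0, 1] ![1, 0]
  have a2 := h1 ![1, 0] ![0, 1] ![0, 1]
  have a3 := h2 ![1, 0] ![1, 0] ![0, 1]
  have a4 := h2 ![0, 1] ![1, 0] ![0, 1]
  have b1 := h3 ![1, 0]
  have b2 := h3 ![0, 1]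
  -- Polarization: alternation at the two basis vectors and at their sum gives skew-symmetry.
  have b3 := h3 (![1, 0] + ![0, 1])
  rw [map_add] at b3
  simp only [dotProduct, Fin.sum_univ_two] at b1 b2 b3
  simp [trilinear] at a1 a2 a3 a4 b1 b2 b3
  rw [b1, b2] at b3
  rw [hφ]
  refine Prod.ext (Matrix.ext fun i j => ?_) (funext fun i => ?_)
  · fin_cases i <;> fin_cases j <;> simp [cubicEnd, trilinear] <;> grind
  · fin_cases i <;> simp <;> grind

/-- The coordinate on `U` complementary to `ca`, `cb`, `cc`, `cd`: the value
`φ₂(v₁)(v₂)` of the alternating form. -/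
noncomputable def ce (u : U) : ℂ := (phi u ![1, 0]).2 1

lemma phi_apply (u : U) (x : E) : phi u x =
    (cubicEnd ![-cc u, -cd u, ca u, cb u] x, ![-ce u * x 1, ce u * x 0]) := by
  rw [(isTrialitySymmetric_phi u).apply_eq]
  simp only [cc, cd, ca, cb, ce, neg_neg]

/-- The class in `U` with given cubic and given alternating form. -/
noncomputable def lowerU (q : Fin 4 → ℂ) (e : ℂ) : U := p.mkQ (lowerCubic q + lowerAlt e)

lemma phi_lowerU (q : Fin 4 → ℂ) (e : ℂ) (x : E) :
    phi (lowerU q e) x = (cubicEnd q x, ![-e * x 1, e * x 0]) := by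
  rw [lowerU, phi_mk]
  refine Prod.ext (by simp [lowerCubic, lowerAlt]) (funext fun i => ?_)
  simp only [Submodule.coe_add, LinearMap.add_apply, Oct.f_add, Pi.add_apply]
  fin_cases i <;> simp [lowerCubic, lowerAlt]

lemma range_phi (φ : E →ₗ[ℂ] EndE × EDual) :
    φ ∈ LinearMap.range phi ↔ IsTrialitySymmetric φ := by
  constructor
  · rintro ⟨u, rfl⟩
    exact isTrialitySymmetric_phi u
  · intro h
    exact ⟨lowerU _ _, LinearMap.ext fun x => by rw [phi_lowerU, h.apply_eq]⟩

lemma cubicForm_eq (u : U) (x : E) : cubicForm u x =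
    -cc u * x 0 ^ 3 - 3 * cd u * x 0 ^ 2 * x 1 + 3 * ca u * x 0 * x 1 ^ 2 + cb u * x 1 ^ 3 := by
  simp only [cubicForm, trilinear, phi_apply, Matrix.mulVec, dotProduct, Fin.sum_univ_two]
  simp [cubicEnd]
  ring

lemma mem_U'_iff (u : U) : u ∈ U' ↔ ce u = 0 := by
  change (∀ x, (phi u x).2 = 0) ↔ _
  refine ⟨fun h => congrFun (h _) 1, fun h x => ?_⟩
  rw [phi_apply, h]
  simp

lemma ext_coords {u v : U} (ha : ca u = ca v) (hb : cb u = cb v) (hc : cc u = cc v)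
    (hd : cd u = cd v) (he : ce u = ce v) : u = v :=
  phi_injective (LinearMap.ext fun x => by rw [phi_apply, phi_apply, ha, hb, hc, hd, he])

@[simp] lemma ca_lowerU (q : Fin 4 → ℂ) (e : ℂ) : ca (lowerU q e) = q 2 := by
  simp [ca, trilinear, phi_lowerU, cubicEnd]

@[simp] lemma cb_lowerU (q : Fin 4 → ℂ) (e : ℂ) : cb (lowerU q e) = q 3 := by
  simp [cb, trilinear, phi_lowerU, cubicEnd]

@[simp] lemma cc_lowerU (q : Fin 4 → ℂ) (e : ℂ) : cc (lowerU q e) = -q 0 := by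
  simp [cc, trilinear, phi_lowerU, cubicEnd]

@[simp] lemma cd_lowerU (q : Fin 4 → ℂ) (e : ℂ) : cd (lowerU q e) = -q 1 := by
  simp [cd, trilinear, phi_lowerU, cubicEnd]

@[simp] lemma ce_lowerU (q : Fin 4 → ℂ) (e : ℂ) : ce (lowerU q e) = e := by
  simp [ce, phi_lowerU]

/-- The linear coordinates `a, b, c, d, e` on `U`. -/
noncomputable def coords : U ≃ₗ[ℂ] (Fin 5 → ℂ) where
  toFun u := ![ca u, cb u, cc u, cd u, ce u]
  map_add' u v := by
    ext i
    fin_cases i <;> simp [ca, cb, cc, cd, ce, trilinear, Matrix.add_mulVec] <;> ring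
  map_smul' r u := by
    ext i
    fin_cases i <;> simp [ca, cb, cc, cd, ce, trilinear, Matrix.smul_mulVec]
  invFun w := lowerU ![-w 2, -w 3, w 0, w 1] (w 4)
  left_inv u := by apply ext_coords <;> simp
  right_inv w := by
    ext i
    fin_cases i <;> simp

lemma finrank_U : Module.finrank ℂ U = 5 := by
  rw [coords.finrank_eq, Module.finrank_fin_fun]

lemma coords_apply (u : U) : coords u = ![ca u, cb u, cc u, cd u, ce u] := rfl

lemma isPolyFun_ca : IsPolyFun ca := IsPolyFun.linear (LinearMap.proj 0 ∘ₗ coords.toLinearMap)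
lemma isPolyFun_cb : IsPolyFun cb := IsPolyFun.linear (LinearMap.proj 1 ∘ₗ coords.toLinearMap)
lemma isPolyFun_cc : IsPolyFun cc := IsPolyFun.linear (LinearMap.proj 2 ∘ₗ coords.toLinearMap)
lemma isPolyFun_cd : IsPolyFun cd := IsPolyFun.linear (LinearMap.proj 3 ∘ₗ coords.toLinearMap)
lemma isPolyFun_ce : IsPolyFun ce := IsPolyFun.linear (LinearMap.proj 4 ∘ₗ coords.toLinearMap)

/-! ### The action of `P` on `U`: invariance of `U'`, Levi subgroup, unipotent elements -/

lemma G2_map_octMul (g : G2) (u v : Oct) : (g : Oct ≃ₗ[ℂ] Oct) (octMul u v) =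
    octMul ((g : Oct ≃ₗ[ℂ] Oct) u) ((g : Oct ≃ₗ[ℂ] Oct) v) := g.2 u v

lemma AdU_mk (g : P) (D : g2) : AdU g (p.mkQ D) = p.mkQ (Ad g D) := rfl

lemma Ad_apply_apply (g : G2) (D : g2) (u : Oct) :
    (Ad g D : Oct →ₗ[ℂ] Oct) ((g : Oct ≃ₗ[ℂ] Oct) u) =
      (g : Oct ≃ₗ[ℂ] Oct) ((D : Oct →ₗ[ℂ] Oct) u) := by
  change (g : Oct ≃ₗ[ℂ] Oct) ((D : Oct →ₗ[ℂ] Oct) ((g : Oct ≃ₗ[ℂ] Oct).symm _)) = _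
  rw [LinearEquiv.symm_apply_apply]

/-- The action of an element of `P` on `E`, as an invertible matrix. -/
lemma exists_matrix (g : P) : ∃ A B : EndE, A * B = 1 ∧
    ∀ x, ((g : G2) : Oct ≃ₗ[ℂ] Oct) ⟨x, 0, 0⟩ = ⟨A *ᵥ x, 0, 0⟩ := by
  have h : ∀ g : P, ∃ A : EndE,
      ∀ x, ((g : G2) : Oct ≃ₗ[ℂ] Oct) ⟨x, 0, 0⟩ = ⟨A *ᵥ x, 0, 0⟩ := by
    intro g
    have hg : ∀ u ∈ subE, ((g : G2) : Oct ≃ₗ[ℂ] Oct) u ∈ subE := by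
      intro u hu
      have h1 : subE.map ((g : G2) : Oct ≃ₗ[ℂ] Oct).toLinearMap = subE := g.2
      rw [← h1]
      exact ⟨u, hu, rfl⟩
    refine ⟨Matrix.of fun i j => (((g : G2) : Oct ≃ₗ[ℂ] Oct) (basisE j)).x i, fun x => ?_⟩
    have hx := hg ⟨x, 0, 0⟩ ⟨rfl, rfl⟩
    refine Oct.ext (funext fun i => ?_) hx.1 hx.2
    rw [Oct.eq_sum ⟨x, 0, 0⟩]
    simp only [Matrix.mulVec, dotProduct, Fin.sum_univ_two, map_add, map_smul, Pi.zero_apply,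
      Matrix.zero_apply, zero_smul, add_zero, Oct.x_add, Oct.x_smul, Pi.add_apply, Pi.smul_apply,
      smul_eq_mul, Matrix.of_apply]
    ring
  obtain ⟨A, hA⟩ := h g
  obtain ⟨B, hB⟩ := h g⁻¹
  refine ⟨A, B, ?_, hA⟩
  have h1 : ∀ x, (A * B) *ᵥ x = (1 : EndE) *ᵥ x := by
    intro x
    have h2 : ((g : G2) : Oct ≃ₗ[ℂ] Oct) ((((g⁻¹ : P) : G2) : Oct ≃ₗ[ℂ] Oct) ⟨x, 0, 0⟩) =
        ⟨x, 0, 0⟩ := ((g : G2) : Oct ≃ₗ[ℂ] Oct).apply_symm_apply _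
    rw [hB, hA] at h2
    rw [← Matrix.mulVec_mulVec, Matrix.one_mulVec]
    exact congrArg Oct.x h2
  exact Matrix.ext_of_mulVec_single fun i => h1 _

/-- For `u ∈ U'` the product `y · D x` stays in `E` and equals `φ₁(x)(y)` there. As `g` is
multiplicative and acts on `E` by `A`, this relation transforms through `A` alone. The twist appears
because `A y ∧ A w = det A · (y ∧ w)`. -/
lemma AdU_of_mem_U' (g : P) {A B : EndE} (hAB : A * B = 1)
    (hA : ∀ x, ((g : G2) : Oct ≃ₗ[ℂ] Oct) ⟨x, 0, 0⟩ = ⟨A *ᵥ x, 0, 0⟩) {u : U} (hu : u ∈ U') :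
    AdU g u ∈ U' ∧ ∀ x, cubicForm (AdU g u) (A *ᵥ x) = A.det * cubicForm u x := by
  obtain ⟨D, rfl⟩ := p.mkQ_surjective u
  have h1 : ∀ x y, octMul ⟨A *ᵥ y, 0, 0⟩ ((Ad g D : Oct →ₗ[ℂ] Oct) ⟨A *ᵥ x, 0, 0⟩) =
      ⟨A *ᵥ (((D : Oct →ₗ[ℂ] Oct) ⟨x, 0, 0⟩).ξ *ᵥ y), 0, 0⟩ := by
    intro x y
    have hf : ((D : Oct →ₗ[ℂ] Oct) ⟨x, 0, 0⟩).f = 0 := hu x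
    have h2 : octMul ⟨y, 0, 0⟩ ((D : Oct →ₗ[ℂ] Oct) ⟨x, 0, 0⟩) =
        ⟨((D : Oct →ₗ[ℂ] Oct) ⟨x, 0, 0⟩).ξ *ᵥ y, 0, 0⟩ := by
      apply Oct.ext <;> simp [octMul, hf, conjEnd]
    rw [← hA, ← hA, ← hA, ← h2, Ad_apply_apply, G2_map_octMul]
  have hx : ∀ x, A *ᵥ (B *ᵥ x) = x := fun x => by
    rw [Matrix.mulVec_mulVec, hAB, Matrix.one_mulVec]
  have hf : ∀ x, ((Ad g D : Oct →ₗ[ℂ] Oct) ⟨x, 0, 0⟩).f = 0 := by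
    intro x
    -- A nonzero `E*` component would survive in the `End(E)` component of the product. Multiplying
    -- by one basis vector and reading the opposite diagonal entry isolates each coordinate of it.
    have h2 := fun w i => congrFun (congrFun (congrArg Oct.ξ (h1 (B *ᵥ x) (B *ᵥ w))) i) i
    simp only [hx, octMul_ξ, Matrix.zero_apply, Matrix.one_apply_eq, Pi.zero_apply] at h2
    ext i
    fin_cases i
    · simpa using h2 (Pi.single 0 1) 1
    · simpa using h2 (Pi.single 1 1) 0
  refine ⟨fun x => hf x, fun x => ?_⟩
  have h3 : ((Ad g D : Oct →ₗ[ℂ] Oct) ⟨A *ᵥ x, 0, 0⟩).ξ *ᵥ (A *ᵥ x) =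
      A *ᵥ (((D : Oct →ₗ[ℂ] Oct) ⟨x, 0, 0⟩).ξ *ᵥ x) := by
    refine Eq.trans ?_ (congrArg Oct.x (h1 x x))
    simp [octMul, conjEnd]
  simp only [AdU_mk, cubicForm, trilinear, phi_mk, h3]
  simp only [Matrix.det_fin_two, Matrix.mulVec, dotProduct, Fin.sum_univ_two]
  ring

/-- The element of `G₂` induced by an invertible matrix acting on `E`. -/
noncomputable def leviG2 (h : EndEˣ) : G2 where
  val :=
    { toFun := fun u => ⟨(h : EndE) *ᵥ u.x, h * u.ξ * (h⁻¹ : EndEˣ), u.f ᵥ* (h⁻¹ : EndEˣ)⟩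
      map_add' := fun u v => by
        apply Oct.ext <;> simp [Matrix.mulVec_add, mul_add, add_mul, Matrix.add_vecMul]
      map_smul' := fun r u => by
        apply Oct.ext <;> simp [Matrix.mulVec_smul, Matrix.smul_vecMul]
      invFun := fun u => ⟨(h⁻¹ : EndEˣ) *ᵥ u.x, (h⁻¹ : EndEˣ) * u.ξ * h, u.f ᵥ* h⟩
      left_inv := fun u => by
        apply Oct.ext <;>
          simp only [Matrix.mulVec_mulVec, Matrix.vecMul_vecMul, Units.inv_mul,
            Matrix.one_mulVec, Matrix.vecMul_one, mul_assoc, Units.inv_mul_cancel_left, mul_one]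
      right_inv := fun u => by
        apply Oct.ext <;>
          simp only [Matrix.mulVec_mulVec, Matrix.vecMul_vecMul, Units.mul_inv,
            Matrix.one_mulVec, Matrix.vecMul_one, mul_assoc, Units.mul_inv_cancel_left, mul_one] }
  property u v := by
    have h1 : ∀ ξ : EndE, conjEnd (h * (ξ * (h⁻¹ : EndEˣ))) =
        h * (conjEnd ξ * (h⁻¹ : EndEˣ)) := by
      intro ξ
      rw [← mul_assoc, ← mul_assoc]
      rw [conjEnd, Matrix.trace_mul_comm, ← mul_assoc, Units.inv_mul, one_mul, conjEnd, mul_sub,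
        sub_mul]
      simp
    have h2 : ∀ (x : E) (f : EDual),
        Matrix.vecMulVec ((h : EndE) *ᵥ x) (f ᵥ* ((h⁻¹ : EndEˣ) : EndE)) =
        (h : EndE) * Matrix.vecMulVec x f * (h⁻¹ : EndEˣ) := by
      intro x f
      rw [Matrix.mul_vecMulVec, Matrix.vecMulVec_mul]
    apply Oct.ext <;>
      simp only [octMul, LinearEquiv.coe_mk, LinearMap.coe_mk, AddHom.coe_mk, h1, h2, mul_assoc,
        Matrix.mulVec_mulVec, Matrix.vecMul_vecMul, Matrix.mulVec_add, Matrix.add_vecMul,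
        mul_add, add_mul, Units.inv_mul_cancel_left, Units.inv_mul, mul_one]

lemma mem_P_of_matrix {g : G2} {A B : EndE} (hAB : A * B = 1)
    (hA : ∀ x, (g : Oct ≃ₗ[ℂ] Oct) ⟨x, 0, 0⟩ = ⟨A *ᵥ x, 0, 0⟩) : g ∈ P := by
  change subE.map (g : Oct ≃ₗ[ℂ] Oct).toLinearMap = subE
  refine le_antisymm ?_ ?_
  · rintro _ ⟨⟨x, ξ, f⟩, ⟨rfl, rfl⟩, rfl⟩
    exact ⟨congrArg Oct.ξ (hA x), congrArg Oct.f (hA x)⟩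
  · rintro ⟨x, ξ, f⟩ ⟨rfl, rfl⟩
    refine ⟨⟨B *ᵥ x, 0, 0⟩, ⟨rfl, rfl⟩, (hA _).trans ?_⟩
    rw [Matrix.mulVec_mulVec, hAB, Matrix.one_mulVec]

lemma leviG2_apply (h : EndEˣ) (u : Oct) : (leviG2 h : Oct ≃ₗ[ℂ] Oct) u =
    ⟨(h : EndE) *ᵥ u.x, h * u.ξ * (h⁻¹ : EndEˣ), u.f ᵥ* (h⁻¹ : EndEˣ)⟩ := rfl

lemma leviG2_E (h : EndEˣ) (x : E) :
    (leviG2 h : Oct ≃ₗ[ℂ] Oct) ⟨x, 0, 0⟩ = ⟨(h : EndE) *ᵥ x, 0, 0⟩ := by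
  rw [leviG2_apply]
  simp

/-- The Levi subgroup `GL(E)` of `P`. -/
noncomputable def levi (h : EndEˣ) : P :=
  ⟨leviG2 h, mem_P_of_matrix (Units.mul_inv h) (leviG2_E h)⟩

lemma phi_AdU_levi (h : EndEˣ) (u : U) (x : E) : phi (AdU (levi h) u) ((h : EndE) *ᵥ x) =
    (h * (phi u x).1 * (h⁻¹ : EndEˣ), (phi u x).2 ᵥ* (h⁻¹ : EndEˣ)) := by
  obtain ⟨D, rfl⟩ := p.mkQ_surjective u
  rw [AdU_mk, phi_mk, phi_mk, ← leviG2_E, show ((levi h : P) : G2) = leviG2 h from rfl,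
    Ad_apply_apply, leviG2_apply]

/-- The exponential of a derivation `D` with `D³ = 0`, as a linear map. -/
noncomputable def expLin (D : Oct →ₗ[ℂ] Oct) : Oct →ₗ[ℂ] Oct :=
  LinearMap.id + D + (2⁻¹ : ℂ) • D ∘ₗ D

lemma expLin_apply (D : Oct →ₗ[ℂ] Oct) (u : Oct) :
    expLin D u = u + D u + (2⁻¹ : ℂ) • D (D u) := rfl

lemma expLin_comp_neg {D : Oct →ₗ[ℂ] Oct} (hD : ∀ u, D (D (D u)) = 0) :
    expLin D ∘ₗ expLin (-D) = LinearMap.id := by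
  refine LinearMap.ext fun u => ?_
  simp only [LinearMap.comp_apply, expLin_apply, LinearMap.neg_apply, map_add, map_smul, map_neg,
    map_zero, neg_neg, hD, smul_zero, LinearMap.id_apply, add_zero]
  module

/-- The exponential of a derivation `D` with `D³ = 0` is an automorphism. -/
noncomputable def expG2 (D : g2) (hD : ∀ u, (D : Oct →ₗ[ℂ] Oct)
    ((D : Oct →ₗ[ℂ] Oct) ((D : Oct →ₗ[ℂ] Oct) u)) = 0) : G2 where
  val := LinearEquiv.ofLinearMap (expLin D) (expLin (-D)) (expLin_comp_neg hD) (by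
    have h := expLin_comp_neg (D := -(D : Oct →ₗ[ℂ] Oct)) (fun u => by simp [hD])
    rwa [neg_neg] at h)
  property u v := by
    -- Expanding `exp(D) u · exp(D) v` leaves terms of order 3 and 4 in `D` that are absent from
    -- `exp(D)(u v)`. The cubic ones vanish by expanding `D³(u v) = 0`, and the quartic one by
    -- applying `D` once more.
    have h1 : octMul ((D : Oct →ₗ[ℂ] Oct) ((D : Oct →ₗ[ℂ] Oct) u)) ((D : Oct →ₗ[ℂ] Oct) v) +
        octMul ((D : Oct →ₗ[ℂ] Oct) u) ((D : Oct →ₗ[ℂ] Oct) ((D : Oct →ₗ[ℂ] Oct) v)) = 0 := by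
      have h := hD (octMul u v)
      simp only [g2_leibniz, map_add, hD, octMul_zero_left, octMul_zero_right] at h
      have h' : (3 : ℂ) • (octMul ((D : Oct →ₗ[ℂ] Oct) ((D : Oct →ₗ[ℂ] Oct) u))
        ((D : Oct →ₗ[ℂ] Oct) v) + octMul ((D : Oct →ₗ[ℂ] Oct) u)
        ((D : Oct →ₗ[ℂ] Oct) ((D : Oct →ₗ[ℂ] Oct) v))) = 0 := by
        rw [← h]
        module
      exact (smul_eq_zero.1 h').resolve_left three_ne_zero
    have h2 : octMul ((D : Oct →ₗ[ℂ] Oct) ((D : Oct →ₗ[ℂ] Oct) u))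
        ((D : Oct →ₗ[ℂ] Oct) ((D : Oct →ₗ[ℂ] Oct) v)) = 0 := by
      have h := congrArg (D : Oct →ₗ[ℂ] Oct) h1
      simp only [g2_leibniz, map_add, hD, octMul_zero_left, octMul_zero_right, map_zero] at h
      have h' : (2 : ℂ) • octMul ((D : Oct →ₗ[ℂ] Oct) ((D : Oct →ₗ[ℂ] Oct) u))
        ((D : Oct →ₗ[ℂ] Oct) ((D : Oct →ₗ[ℂ] Oct) v)) = 0 := by
        rw [← h]
        module
      exact (smul_eq_zero.1 h').resolve_left two_ne_zero
    simp only [LinearEquiv.coe_ofLinearMap, expLin_apply, g2_leibniz, map_add, octMul_add_left,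
      octMul_add_right, octMul_smul_left, octMul_smul_right, h2, smul_zero]
    have h3 := eq_neg_of_add_eq_zero_left h1
    rw [h3]
    module

/-- Degree 1 moves `E*` to `End(E)`, `End(E)` to `E` and `E` to zero. -/
lemma upperCubic_cube (q : Fin 4 → ℂ) (u : Oct) : (upperCubic q : Oct →ₗ[ℂ] Oct)
    ((upperCubic q : Oct →ₗ[ℂ] Oct) ((upperCubic q : Oct →ₗ[ℂ] Oct) u)) = 0 := by
  apply Oct.ext_coords <;>
    simp [upperCubic_x, upperCubic_ξ, upperCubic_f, cubicEnd, Fin.forall_fin_two]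

lemma upperCubic_E (q : Fin 4 → ℂ) (x : E) :
    (upperCubic q : Oct →ₗ[ℂ] Oct) ⟨x, 0, 0⟩ = 0 := by
  apply Oct.ext_coords <;>
    simp [upperCubic_x, upperCubic_ξ, upperCubic_f, cubicEnd, Fin.forall_fin_two]

lemma expG2_apply (D : g2) (hD) (u : Oct) : (expG2 D hD : Oct ≃ₗ[ℂ] Oct) u =
    u + (D : Oct →ₗ[ℂ] Oct) u + (2⁻¹ : ℂ) • (D : Oct →ₗ[ℂ] Oct) ((D : Oct →ₗ[ℂ] Oct) u) := rfl

lemma expG2_upperCubic_E (q : Fin 4 → ℂ) (x : E) :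
    (expG2 (upperCubic q) (upperCubic_cube q) : Oct ≃ₗ[ℂ] Oct) ⟨x, 0, 0⟩ = ⟨x, 0, 0⟩ := by
  rw [expG2_apply, upperCubic_E, map_zero, smul_zero, add_zero, add_zero]

/-- The exponentials in `P` of the derivations of degree `1`. -/
noncomputable def unip (q : Fin 4 → ℂ) : P :=
  ⟨expG2 (upperCubic q) (upperCubic_cube q), mem_P_of_matrix (one_mul 1)
    fun x => by rw [expG2_upperCubic_E, Matrix.one_mulVec]⟩

/-- The exponential fixes `E` pointwise, so `Ad g D` sends `x` to `g (D x)`. Modulo `E` the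
quadratic term and the image of `End(E)` drop out, and only the contribution of `φ₂` remains. -/
lemma phi_AdU_unip (q : Fin 4 → ℂ) (u : U) (x : E) : phi (AdU (unip q) u) x =
    ((phi u x).1 + (cubicEnd q (phi u x).2)ᵀ, (phi u x).2) := by
  obtain ⟨D, rfl⟩ := p.mkQ_surjective u
  rw [AdU_mk, phi_mk, phi_mk, show ((unip q : P) : G2) = expG2 _ (upperCubic_cube q) from rfl]
  conv_lhs => rw [← expG2_upperCubic_E q]
  rw [Ad_apply_apply, expG2_apply]
  refine Prod.ext (Matrix.ext fun i j => ?_) (funext fun i => ?_) <;>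
    simp [upperCubic_ξ, upperCubic_f]
  fin_cases i <;> fin_cases j <;> simp [cubicEnd]

/-! ### Binary forms and their factorization -/

section BinaryForms

/-- The linear form on `E` with coefficients `l 0`, `l 1`. -/
def linForm (l : Fin 2 → ℂ) : E →ₗ[ℂ] ℂ :=
  l 0 • LinearMap.proj 0 + l 1 • LinearMap.proj 1

@[simp] lemma linForm_apply (l : Fin 2 → ℂ) (x : E) : linForm l x = l 0 * x 0 + l 1 * x 1 := rfl

lemma exists_eq_linForm (l : E →ₗ[ℂ] ℂ) : ∃ m, l = linForm m := by
  refine ⟨fun i => l (Pi.single i 1), LinearMap.pi_ext' fun i => LinearMap.ext_ring ?_⟩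
  fin_cases i <;> simp

/-- The determinant of two linear forms. -/
def formDet (l m : Fin 2 → ℂ) : ℂ := l 0 * m 1 - l 1 * m 0

/-- If the coefficient of `y²` vanishes, `x` is a factor. Otherwise a root `y` of the dehomogenized
polynomial gives the factor `![-y, 1]`, which vanishes at `(1, y)`. -/
lemma exists_factor_quadratic (s q r : ℂ) : ∃ l m : Fin 2 → ℂ,
    s = l 0 * m 0 ∧ q = l 0 * m 1 + l 1 * m 0 ∧ r = l 1 * m 1 := by
  by_cases hr : r = 0
  · exact ⟨![1, 0], ![s, q], by simp, by simp, by simp [hr]⟩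
  · obtain ⟨y, hy⟩ := IsAlgClosed.exists_root
      (Polynomial.C r * Polynomial.X ^ 2 + Polynomial.C q * Polynomial.X + Polynomial.C s)
      (by rw [Polynomial.degree_quadratic hr]; norm_num)
    simp only [Polynomial.IsRoot, Polynomial.eval_add, Polynomial.eval_mul, Polynomial.eval_C,
      Polynomial.eval_pow, Polynomial.eval_X] at hy
    refine ⟨![-y, 1], ![q + r * y, r], ?_, ?_, ?_⟩ <;> simp
    · linear_combination hy
    · ring

/-- The same splitting of one linear factor, with the quotient handed to `exists_factor_quadratic`.
-/
lemma exists_factor_cubic (s q r t : ℂ) : ∃ l m n : Fin 2 → ℂ,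
    s = l 0 * m 0 * n 0 ∧ q = l 0 * m 0 * n 1 + l 0 * m 1 * n 0 + l 1 * m 0 * n 0 ∧
    r = l 0 * m 1 * n 1 + l 1 * m 0 * n 1 + l 1 * m 1 * n 0 ∧ t = l 1 * m 1 * n 1 := by
  by_cases ht : t = 0
  · obtain ⟨m, n, h1, h2, h3⟩ := exists_factor_quadratic s q r
    refine ⟨![1, 0], m, n, ?_, ?_, ?_, ?_⟩ <;> simp [h1, h2, h3, ht]
  · obtain ⟨y, hy⟩ := IsAlgClosed.exists_root
      (Polynomial.C t * Polynomial.X ^ 3 + Polynomial.C r * Polynomial.X ^ 2 +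
        Polynomial.C q * Polynomial.X + Polynomial.C s)
      (by rw [Polynomial.degree_cubic ht]; norm_num)
    simp only [Polynomial.IsRoot, Polynomial.eval_add, Polynomial.eval_mul, Polynomial.eval_C,
      Polynomial.eval_pow, Polynomial.eval_X] at hy
    obtain ⟨m, n, h1, h2, h3⟩ := exists_factor_quadratic (q + r * y + t * y ^ 2) (r + t * y) t
    refine ⟨![-y, 1], m, n, ?_, ?_, ?_, ?_⟩ <;> simp
    · linear_combination hy - y * h1
    · linear_combination h1 - y * h2
    · linear_combination h2 - y * h3
    · linear_combination h3

/-- Linear forms with vanishing determinant are proportional. -/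
lemma eq_zero_or_exists_smul {l m : Fin 2 → ℂ} (h : formDet l m = 0) :
    l = 0 ∨ ∃ k : ℂ, ∀ i, m i = k * l i := by
  rw [formDet] at h
  by_cases h0 : l 0 = 0
  · by_cases h1 : l 1 = 0
    · left
      ext i
      fin_cases i
      · exact h0
      · exact h1
    · refine Or.inr ⟨m 1 / l 1, fun i => ?_⟩
      fin_cases i <;> simp <;> field_simp
      linear_combination -h
  · refine Or.inr ⟨m 0 / l 0, fun i => ?_⟩
    fin_cases i <;> simp <;> field_simp
    linear_combination h

end BinaryForms

/-! ### Root patterns in `U'`: discriminant and twisted cubic cone -/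

lemma cubicForm_eq_iff {u : U} {s q r t : ℂ} :
    (∀ x, cubicForm u x = s * x 0 ^ 3 + q * x 0 ^ 2 * x 1 + r * x 0 * x 1 ^ 2 + t * x 1 ^ 3) ↔
      s = -cc u ∧ q = -3 * cd u ∧ r = 3 * ca u ∧ t = cb u := by
  constructor
  · intro h
    have h1 := h ![1, 0]
    have h2 := h ![0, 1]
    have h3 := h ![1, 1]
    have h4 := h ![1, -1]
    simp [cubicForm_eq] at h1 h2 h3 h4
    exact ⟨h1.symm, by linear_combination (-h3 + h4) / 2 + h2,
      by linear_combination (-h3 - h4) / 2 + h1, h2.symm⟩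
  · rintro ⟨rfl, rfl, rfl, rfl⟩ x
    rw [cubicForm_eq]
    ring

lemma U'_ext {u v : U} (hu : u ∈ U') (hv : v ∈ U') (h : ∀ x, cubicForm u x = cubicForm v x) :
    u = v := by
  obtain ⟨h1, h2, h3, h4⟩ := (cubicForm_eq_iff (u := u) (s := -cc v) (q := -3 * cd v)
    (r := 3 * ca v) (t := cb v)).1 fun x => by rw [h, cubicForm_eq]; ring
  refine ext_coords ?_ h4.symm ?_ ?_ ?_
  · linear_combination -h3 / 3
  · linear_combination h1
  · linear_combination h2 / 3
  · rw [(mem_U'_iff u).1 hu, (mem_U'_iff v).1 hv]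

lemma exists_cubicForm_eq_mul (u : U) : ∃ l m n, ∀ x,
    cubicForm u x = linForm l x * linForm m x * linForm n x := by
  obtain ⟨l, m, n, h1, h2, h3, h4⟩ := exists_factor_cubic (-cc u) (-3 * cd u) (3 * ca u) (cb u)
  refine ⟨l, m, n, fun x => ?_⟩
  rw [cubicForm_eq]
  simp only [linForm_apply]
  linear_combination h1 * x 0 ^ 3 + h2 * x 0 ^ 2 * x 1 + h3 * x 0 * x 1 ^ 2 + h4 * x 1 ^ 3

/-- The elements of `U'` whose cubic has a double root. -/
def doubleRoot : Set U :=
  {u | u ∈ U' ∧ ∃ l m : E →ₗ[ℂ] ℂ, ∀ x, cubicForm u x = l x ^ 2 * m x}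

/-- The elements of `U'` whose cubic has a triple root. -/
def tripleRoot : Set U :=
  {u | u ∈ U' ∧ ∃ (r : ℂ) (l : E →ₗ[ℂ] ℂ), ∀ x, cubicForm u x = r * l x ^ 3}

lemma tripleRoot_subset : tripleRoot ⊆ doubleRoot := by
  rintro u ⟨hu, r, l, h⟩
  exact ⟨hu, l, r • l, fun x => by rw [h, LinearMap.smul_apply, smul_eq_mul]; ring⟩

lemma mem_doubleRoot_of_formDet {u : U} (hu : u ∈ U') {l m n : Fin 2 → ℂ}
    (h : ∀ x, cubicForm u x = linForm l x * linForm m x * linForm n x)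
    (h0 : formDet l m = 0) : u ∈ doubleRoot := by
  rcases eq_zero_or_exists_smul h0 with rfl | ⟨k, hk⟩
  · exact ⟨hu, 0, 0, fun x => by simp [h]⟩
  · refine ⟨hu, linForm l, k • linForm n, fun x => ?_⟩
    simp only [h, linForm_apply, LinearMap.smul_apply, smul_eq_mul, hk]
    ring

lemma mem_tripleRoot_of_formDet {u : U} (hu : u ∈ U') {l m : Fin 2 → ℂ}
    (h : ∀ x, cubicForm u x = linForm l x ^ 2 * linForm m x)
    (h0 : formDet l m = 0) : u ∈ tripleRoot := by
  rcases eq_zero_or_exists_smul h0 with rfl | ⟨k, hk⟩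
  · exact ⟨hu, 0, 0, fun x => by simp [h]⟩
  · refine ⟨hu, k, linForm l, fun x => ?_⟩
    simp only [h, linForm_apply, hk]
    ring

/-- The homogeneous form of the product of squared root differences. Its vanishing therefore means
that two linear factors are proportional. -/
lemma discQuartic_eq {u : U} {l m n : Fin 2 → ℂ}
    (h : ∀ x, cubicForm u x = linForm l x * linForm m x * linForm n x) :
    discQuartic (3 * ca u) (cb u) (cc u) (3 * cd u) =
      (formDet l m * formDet l n * formDet m n) ^ 2 := by
  obtain ⟨h1, h2, h3, h4⟩ := (cubicForm_eq_iff (u := u) (s := l 0 * m 0 * n 0)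
    (q := l 0 * m 0 * n 1 + l 0 * m 1 * n 0 + l 1 * m 0 * n 0)
    (r := l 0 * m 1 * n 1 + l 1 * m 0 * n 1 + l 1 * m 1 * n 0) (t := l 1 * m 1 * n 1)).1
    fun x => by rw [h]; simp only [linForm_apply]; ring
  have h1' : cc u = -(l 0 * m 0 * n 0) := by linear_combination h1
  have h2' : 3 * cd u = -(l 0 * m 0 * n 1 + l 0 * m 1 * n 0 + l 1 * m 0 * n 0) := by
    linear_combination h2
  rw [h1', h2', ← h3, ← h4]
  simp only [discQuartic, formDet]
  ring

lemma doubleRoot_eq_disc : doubleRoot =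
    {u | u ∈ U' ∧ discQuartic (3 * ca u) (cb u) (cc u) (3 * cd u) = 0} := by
  ext u
  constructor
  · rintro ⟨hu, l, m, h⟩
    obtain ⟨l, rfl⟩ := exists_eq_linForm l
    obtain ⟨m, rfl⟩ := exists_eq_linForm m
    refine ⟨hu, ?_⟩
    rw [discQuartic_eq (l := l) (m := l) (n := m) fun x => by rw [h]; ring]
    simp only [formDet]
    ring
  · rintro ⟨hu, h0⟩
    obtain ⟨l, m, n, h⟩ := exists_cubicForm_eq_mul u
    rw [discQuartic_eq h] at h0
    rcases mul_eq_zero.1 (pow_eq_zero_iff two_ne_zero |>.1 h0) with h1 | h1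
    · rcases mul_eq_zero.1 h1 with h2 | h2
      · exact mem_doubleRoot_of_formDet hu h h2
      · exact mem_doubleRoot_of_formDet hu (n := m) (fun x => by rw [h]; ring) h2
    · exact mem_doubleRoot_of_formDet hu (n := l) (fun x => by rw [h]; ring) h1

lemma tripleRoot_eq_param : tripleRoot =
    {u | u ∈ U' ∧ ∃ r s t : ℂ, cb u = r * s ^ 3 ∧ ca u = r * (s ^ 2 * t) ∧
      -cd u = r * (s * t ^ 2) ∧ -cc u = r * t ^ 3} := by
  ext u
  constructor
  · rintro ⟨hu, r, l, h⟩
    obtain ⟨l, rfl⟩ := exists_eq_linForm l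
    obtain ⟨h1, h2, h3, h4⟩ := (cubicForm_eq_iff (u := u) (s := r * l 0 ^ 3)
      (q := 3 * r * l 0 ^ 2 * l 1) (r := 3 * r * l 0 * l 1 ^ 2) (t := r * l 1 ^ 3)).1
      fun x => by rw [h]; simp only [linForm_apply]; ring
    -- The coefficients of `l` enter in reverse order, since `b`, the coefficient of `y³`,
    -- corresponds to `s³`.
    exact ⟨hu, r, l 1, l 0, h4.symm, by linear_combination -h3 / 3,
      by linear_combination -h2 / 3, h1.symm⟩
  · rintro ⟨hu, r, s, t, hb, ha, hd, hc⟩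
    refine ⟨hu, r, linForm ![t, s], fun x => ?_⟩
    rw [cubicForm_eq, hb, ha, hc]
    simp
    linear_combination 3 * x 0 ^ 2 * x 1 * hd

lemma tripleRoot_eq_minors : tripleRoot =
    {u | u ∈ U' ∧ ca u ^ 2 + cb u * cd u = 0 ∧ ca u * cd u - cb u * cc u = 0 ∧
      cd u ^ 2 + ca u * cc u = 0} := by
  rw [tripleRoot_eq_param]
  ext u
  constructor
  · rintro ⟨hu, r, s, t, hb, ha, hd, hc⟩
    have hd' : cd u = -(r * (s * t ^ 2)) := by linear_combination -hd
    have hc' : cc u = -(r * t ^ 3) := by linear_combination -hc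
    refine ⟨hu, ?_, ?_, ?_⟩ <;> rw [ha, hd'] <;> try rw [hb]
    all_goals try rw [hc']
    all_goals ring
  · rintro ⟨hu, h1, h2, h3⟩
    refine ⟨hu, ?_⟩
    -- If `b = 0` the minors force `a = d = 0`, which is the point `s = 0` of the twisted cubic.
    -- Otherwise the chart `s = 1` applies, with `t = a / b`.
    by_cases hb : cb u = 0
    · rw [hb] at h1
      have ha : ca u = 0 := by simpa using h1
      rw [ha] at h3
      have hd : cd u = 0 := by simpa using h3
      exact ⟨-cc u, 0, 1, by simp [hb], by simp [ha], by simp [hd], by simp⟩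
    · refine ⟨cb u, 1, ca u / cb u, by simp, by field_simp, ?_, ?_⟩
      · field_simp
        linear_combination -h1
      · field_simp
        linear_combination cb u * h2 - ca u * h1

lemma tripleRoot_eq_rank : tripleRoot =
    {u | u ∈ U' ∧ (!![ca u, -cd u, cc u; cb u, ca u, cd u]).rank ≤ 1} := by
  refine Set.Subset.antisymm ?_ ?_
  · rw [tripleRoot_eq_param]
    rintro u ⟨hu, r, s, t, hb, ha, hd, hc⟩
    refine ⟨hu, ?_⟩
    have h : !![ca u, -cd u, cc u; cb u, ca u, cd u] =
        Matrix.vecMulVec ![t, s] ![r * s ^ 2, r * s * t, -(r * t ^ 2)] := by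
      ext i j
      fin_cases i <;> fin_cases j <;> simp [Matrix.vecMulVec_apply]
      · rw [ha]; ring
      · rw [hd]; ring
      · linear_combination -hc
      · rw [hb]; ring
      · rw [ha]; ring
      · linear_combination -hd
    rw [h]
    exact Matrix.rank_vecMulVec_le _ _
  · rw [tripleRoot_eq_minors]
    rintro u ⟨hu, h⟩
    -- A nonzero 2 × 2 minor would be an invertible submatrix, of rank 2.
    have key : ∀ f : Fin 2 → Fin 3,
        ((!![ca u, -cd u, cc u; cb u, ca u, cd u]).submatrix id f).det = 0 := by
      intro f
      by_contra h0
      have h1 := Matrix.rank_of_isUnit _ ((Matrix.isUnit_iff_isUnit_det _).2 (Ne.isUnit h0))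
      have h2 := Matrix.rank_submatrix_le (!![ca u, -cd u, cc u; cb u, ca u, cd u]) id f
      rw [h1, Fintype.card_fin] at h2
      omega
    have h1 := key ![0, 1]
    have h2 := key ![0, 2]
    have h3 := key ![1, 2]
    simp [Matrix.det_fin_two] at h1 h2 h3
    exact ⟨hu, by linear_combination h1, by linear_combination h2,
      by linear_combination -h3⟩

/-! ### Invariant sets and transitivity on each root pattern -/

lemma AdU_mul_apply (g h : P) (u : U) : AdU (g * h) u = AdU g (AdU h u) := by
  rw [map_mul, Module.End.mul_apply]

lemma AdU_inv_apply_self (g : P) (u : U) : AdU g⁻¹ (AdU g u) = u := by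
  rw [← AdU_mul_apply, inv_mul_cancel, map_one, Module.End.one_apply]

/-- An invariant set contained in one orbit is an orbit. -/
lemma orbit_eq_of_invariant {S : Set U} {v : U} (hS : ∀ (g : P), ∀ u ∈ S, AdU g u ∈ S)
    (hv : S ⊆ orbit v) {u : U} (hu : u ∈ S) : orbit u = S := by
  refine Set.Subset.antisymm ?_ fun w hw => ?_
  · rintro _ ⟨g, rfl⟩
    exact hS g u hu
  · obtain ⟨g, rfl⟩ := hv hw
    obtain ⟨h, rfl⟩ := hv hu
    refine ⟨g * h⁻¹, ?_⟩
    change AdU (g * h⁻¹) (AdU h v) = AdU g v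
    rw [AdU_mul_apply, AdU_inv_apply_self]

/-- The difference of two invariant sets is invariant. -/
lemma invariant_diff {S T : Set U} (hS : ∀ (g : P), ∀ u ∈ S, AdU g u ∈ S)
    (hT : ∀ (g : P), ∀ u ∈ T, AdU g u ∈ T) (g : P) : ∀ u ∈ S \ T, AdU g u ∈ S \ T := by
  refine fun u hu => ⟨hS g u hu.1, fun h => hu.2 ?_⟩
  rw [← AdU_inv_apply_self g u]
  exact hT g⁻¹ _ h

lemma AdU_mem_U' (g : P) (u : U) (hu : u ∈ U') : AdU g u ∈ U' := by
  obtain ⟨A, B, hAB, hA⟩ := exists_matrix g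
  exact (AdU_of_mem_U' g hAB hA hu).1

lemma exists_cubicForm_AdU (g : P) {u : U} (hu : u ∈ U') : ∃ (r : ℂ) (B : EndE),
    ∀ x, cubicForm (AdU g u) x = r * cubicForm u (B *ᵥ x) := by
  obtain ⟨A, B, hAB, hA⟩ := exists_matrix g
  refine ⟨A.det, B, fun x => ?_⟩
  rw [← (AdU_of_mem_U' g hAB hA hu).2, Matrix.mulVec_mulVec, hAB, Matrix.one_mulVec]

lemma AdU_mem_doubleRoot (g : P) (u : U) (hu : u ∈ doubleRoot) : AdU g u ∈ doubleRoot := by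
  obtain ⟨hu, l, m, h⟩ := hu
  obtain ⟨r, B, hB⟩ := exists_cubicForm_AdU g hu
  refine ⟨AdU_mem_U' g u hu, l ∘ₗ B.mulVecLin, r • m ∘ₗ B.mulVecLin, fun x => ?_⟩
  rw [hB, h]
  simp only [LinearMap.smul_apply, LinearMap.comp_apply, Matrix.mulVecLin_apply, smul_eq_mul]
  ring

lemma AdU_mem_tripleRoot (g : P) (u : U) (hu : u ∈ tripleRoot) : AdU g u ∈ tripleRoot := by
  obtain ⟨hu, s, l, h⟩ := hu
  obtain ⟨r, B, hB⟩ := exists_cubicForm_AdU g hu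
  refine ⟨AdU_mem_U' g u hu, r * s, l ∘ₗ B.mulVecLin, fun x => ?_⟩
  rw [hB, h]
  simp only [LinearMap.comp_apply, Matrix.mulVecLin_apply]
  ring

/-- Elements of `U'` whose cubics differ by a substitution are in the same orbit. -/
lemma mem_orbit_of_substitution {u w : U} (hu : u ∈ U') (hw : w ∈ U') (l m : Fin 2 → ℂ)
    (h0 : formDet l m ≠ 0)
    (h : ∀ x, cubicForm u ![linForm l x, linForm m x] = formDet l m * cubicForm w x) :
    w ∈ orbit u := by
  have hdet : (!![l 0, l 1; m 0, m 1]).det = formDet l m := by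
    rw [Matrix.det_fin_two_of, formDet]
  obtain ⟨K, hK⟩ : IsUnit !![l 0, l 1; m 0, m 1] :=
    (Matrix.isUnit_iff_isUnit_det _).2 (hdet ▸ Ne.isUnit h0)
  -- Acting by `K⁻¹` replaces the cubic `F` by `det(K)⁻¹ F(K x)`, and the factor `formDet l m` in
  -- the hypothesis cancels this determinant.
  have hlevi := AdU_of_mem_U' (levi K⁻¹) (Units.inv_mul K) (leviG2_E K⁻¹) hu
  refine ⟨levi K⁻¹, U'_ext hlevi.1 hw fun x => ?_⟩
  have h1 := hlevi.2 ((K : EndE) *ᵥ x)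
  rw [Matrix.mulVec_mulVec, Units.inv_mul, Matrix.one_mulVec] at h1
  have h2 : (K : EndE) *ᵥ x = ![linForm l x, linForm m x] := by
    rw [hK]
    ext i
    fin_cases i <;> simp [Matrix.mulVec, dotProduct]
  have h3 : ((K⁻¹ : EndEˣ) : EndE).det * formDet l m = 1 := by
    rw [← hdet, ← hK, ← Matrix.det_mul, Units.inv_mul, Matrix.det_one]
  rw [h1, h2, h, ← mul_assoc, h3, one_mul]

lemma lowerU_mem_U' (q : Fin 4 → ℂ) : lowerU q 0 ∈ U' := (mem_U'_iff _).2 (ce_lowerU q 0)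

lemma cubicForm_lowerU (q : Fin 4 → ℂ) (e : ℂ) (x : E) : cubicForm (lowerU q e) x =
    q 0 * x 0 ^ 3 + 3 * q 1 * x 0 ^ 2 * x 1 + 3 * q 2 * x 0 * x 1 ^ 2 + q 3 * x 1 ^ 3 := by
  rw [cubicForm_eq]
  simp only [ca_lowerU, cb_lowerU, cc_lowerU, cd_lowerU]
  ring

/-- The cubic `x y (x + y)`. -/
noncomputable def distinctRep : U := lowerU ![0, 1 / 3, 1 / 3, 0] 0

/-- The cubic `x² y`. -/
noncomputable def doubleRep : U := lowerU ![0, 1 / 3, 0, 0] 0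

/-- The cubic `x³`. -/
noncomputable def tripleRep : U := lowerU ![1, 0, 0, 0] 0

lemma distinct_subset_orbit : (U' : Set U) \ doubleRoot ⊆ orbit distinctRep := by
  rintro w ⟨hw, hd⟩
  obtain ⟨l, m, n, h⟩ := exists_cubicForm_eq_mul w
  have h1 : formDet l m ≠ 0 := fun h0 => hd (mem_doubleRoot_of_formDet hw h h0)
  have h2 : formDet l n ≠ 0 := fun h0 =>
    hd (mem_doubleRoot_of_formDet hw (n := m) (fun x => by rw [h]; ring) h0)
  have h3 : formDet m n ≠ 0 := fun h0 =>
    hd (mem_doubleRoot_of_formDet hw (n := l) (fun x => by rw [h]; ring) h0)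
  -- Writing `[l m]` for `formDet l m`, the Plücker relation is `[m n] l - [l n] m + [l m] n = 0`.
  -- With `x = -[m n] l` and `y = [l n] m` it gives `x + y = [l m] n`. So `x y (x + y)` is `l m n`
  -- times `-[m n] [l n] [l m]`, which is also the determinant of the substitution.
  refine mem_orbit_of_substitution (lowerU_mem_U' _) hw (-formDet m n • l) (formDet l n • m) ?_
    fun x => ?_
  · have h4 : formDet (-formDet m n • l) (formDet l n • m) =
        -formDet m n * formDet l n * formDet l m := by
      simp only [formDet, Pi.smul_apply, smul_eq_mul]
      ring
    rw [h4]
    exact mul_ne_zero (mul_ne_zero (neg_ne_zero.2 h3) h2) h1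
  · rw [h, distinctRep, cubicForm_lowerU]
    simp [formDet]
    ring

lemma double_subset_orbit : doubleRoot \ tripleRoot ⊆ orbit doubleRep := by
  rintro w ⟨⟨hw, l, m, h⟩, hd⟩
  obtain ⟨l, rfl⟩ := exists_eq_linForm l
  obtain ⟨m, rfl⟩ := exists_eq_linForm m
  have h1 : formDet l m ≠ 0 := fun h0 => hd (mem_tripleRoot_of_formDet hw h h0)
  -- Scaling `l` by `[l m]` makes both the determinant and the factor in front of `l² m` equal to
  -- `[l m]²`.
  refine mem_orbit_of_substitution (lowerU_mem_U' _) hw (formDet l m • l) m ?_ fun x => ?_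
  · have h4 : formDet (formDet l m • l) m = formDet l m * formDet l m := by
      simp only [formDet, Pi.smul_apply, smul_eq_mul]
      ring
    rw [h4]
    exact mul_ne_zero h1 h1
  · rw [h, doubleRep, cubicForm_lowerU]
    simp [formDet]
    ring

lemma triple_subset_orbit : tripleRoot \ {0} ⊆ orbit tripleRep := by
  rintro w ⟨⟨hw, r, l, h⟩, hd⟩
  obtain ⟨l, rfl⟩ := exists_eq_linForm l
  have hF : ∃ x, cubicForm w x ≠ 0 := by
    by_contra! h0
    refine hd (U'_ext hw U'.zero_mem fun x => ?_)
    rw [h0, cubicForm_eq]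
    simp [ca, cb, cc, cd, trilinear]
  obtain ⟨x, hx⟩ := hF
  rw [h] at hx
  have hr : r ≠ 0 := left_ne_zero_of_mul hx
  -- The second form is free for `x³`, so it is chosen to make the determinant twist turn `r l³`
  -- into `l³`.
  obtain ⟨m, hm⟩ : ∃ m, formDet l m = r⁻¹ := by
    by_cases h0 : l 0 = 0
    · have h1 : l 1 ≠ 0 := fun h1 => hx (by simp [h0, h1])
      refine ⟨![-(r⁻¹ / l 1), 0], ?_⟩
      simp [formDet]
      field_simp
    · refine ⟨![0, r⁻¹ / l 0], ?_⟩
      simp [formDet]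
      field_simp
  refine mem_orbit_of_substitution (lowerU_mem_U' _) hw l m (hm ▸ inv_ne_zero hr) fun y => ?_
  rw [h, hm, inv_mul_cancel_left₀ hr, tripleRep, cubicForm_lowerU]
  simp

/-- Off `U'` the map `φ₂` is invertible, so a unipotent element can add any cubic and is chosen to
cancel the one present. The matrix `diag(e, 1)` then scales the alternating form by the inverse of
its determinant, to 1. -/
lemma generic_subset_orbit : (Set.univ : Set U) \ U' ⊆ orbit (lowerU 0 1) := by
  rintro w ⟨-, hw⟩
  have he : ce w ≠ 0 := fun h => hw ((mem_U'_iff w).2 h)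
  have hdet : (!![ce w, 0; 0, 1]).det = ce w := by rw [Matrix.det_fin_two_of]; ring
  obtain ⟨K, hK⟩ : IsUnit !![ce w, 0; 0, 1] :=
    (Matrix.isUnit_iff_isUnit_det _).2 (by rw [hdet]; exact Ne.isUnit he)
  have hK' : ((K⁻¹ : EndEˣ) : EndE) = !![(ce w)⁻¹, 0; 0, 1] := by
    refine Units.inv_eq_of_mul_eq_one_right ?_
    rw [hK]
    ext i j
    fin_cases i <;> fin_cases j <;> simp [Matrix.mul_apply, he]
  have hg : AdU (levi K) (AdU
      (unip ![-(cb w / ce w), ca w / ce w, cd w / ce w, -(cc w / ce w)]) w) = lowerU 0 1 := by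
    refine phi_injective (LinearMap.ext fun x => ?_)
    have hx : x = (K : EndE) *ᵥ (((K⁻¹ : EndEˣ) : EndE) *ᵥ x) := by
      rw [Matrix.mulVec_mulVec, Units.mul_inv, Matrix.one_mulVec]
    conv_lhs => rw [hx]
    rw [phi_AdU_levi, phi_AdU_unip, phi_apply, phi_lowerU, hK']
    have h1 : ∀ y : E, cubicEnd ![-cc w, -cd w, ca w, cb w] y +
        (cubicEnd ![-(cb w / ce w), ca w / ce w, cd w / ce w, -(cc w / ce w)]
          ![-ce w * y 1, ce w * y 0])ᵀ = 0 := by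
      intro y
      ext i j
      fin_cases i <;> fin_cases j <;> simp [cubicEnd] <;> field_simp <;> ring
    rw [h1]
    refine Prod.ext ?_ (funext fun i => ?_)
    · ext i j
      fin_cases i <;> fin_cases j <;> simp [cubicEnd]
    · fin_cases i <;> simp [Matrix.mulVec, Matrix.vecMul, dotProduct] <;> field_simp
  refine ⟨(levi K * unip ![-(cb w / ce w), ca w / ce w, cd w / ce w, -(cc w / ce w)])⁻¹, ?_⟩
  change AdU _ (lowerU 0 1) = w
  rw [← hg, ← AdU_mul_apply (levi K), AdU_inv_apply_self]

/-! ### The flag: closedness, irreducibility, strictness -/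

/-- The line of cubics `b y³`. -/
def cubeLine : Set U := {u | ca u = 0 ∧ cc u = 0 ∧ cd u = 0 ∧ ce u = 0}

/-- A full flag of irreducible closed subsets of `U`, containing all orbit closures. -/
noncomputable def flag : ℕ → Set U
  | 0 => Set.univ
  | 1 => U'
  | 2 => doubleRoot
  | 3 => tripleRoot
  | 4 => cubeLine
  | _ => {0}

lemma flag_isZariskiClosed (i : ℕ) : IsZariskiClosed (flag i) := by
  have hU' : IsZariskiClosed {u | ce u = 0} := isPolyFun_ce.isZariskiClosed
  have hU'' : (U' : Set U) = {u | ce u = 0} := Set.ext fun u => mem_U'_iff u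
  have h3 := IsPolyFun.const (V := U) 3
  have hdouble : doubleRoot = {u | ce u = 0} ∩
      {u | discQuartic (3 * ca u) (cb u) (cc u) (3 * cd u) = 0} := by
    rw [doubleRoot_eq_disc, ← hU'']
    rfl
  have htriple : tripleRoot = {u | ce u = 0} ∩ ({u | ca u ^ 2 + cb u * cd u = 0} ∩
      ({u | ca u * cd u - cb u * cc u = 0} ∩ {u | cd u ^ 2 + ca u * cc u = 0})) := by
    rw [tripleRoot_eq_minors, ← hU'']
    rfl
  have hline : cubeLine =
      {u | ca u = 0} ∩ ({u | cc u = 0} ∩ ({u | cd u = 0} ∩ {u | ce u = 0})) := rfl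
  have hline_closed : IsZariskiClosed cubeLine := by
    rw [hline]
    exact isPolyFun_ca.isZariskiClosed.inter (isPolyFun_cc.isZariskiClosed.inter
      (isPolyFun_cd.isZariskiClosed.inter hU'))
  have hzero : ({0} : Set U) = cubeLine ∩ {u | cb u = 0} := by
    ext u
    constructor
    · rintro rfl
      simp [cubeLine, ca, cb, cc, cd, ce, trilinear]
    · rintro ⟨⟨ha, hc, hd, he⟩, hb⟩
      apply coords.injective
      rw [map_zero, coords_apply, ha, show cb u = 0 from hb, hc, hd, he]
      ext i
      fin_cases i <;> rfl
  match i with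
  | 0 => exact Set.Subset.antisymm (Set.subset_univ _) (subset_zariskiClosure _)
  | 1 =>
    change IsZariskiClosed (U' : Set U)
    rwa [hU'']
  | 2 =>
    change IsZariskiClosed doubleRoot
    rw [hdouble]
    have ha := h3.mul isPolyFun_ca
    have hd := h3.mul isPolyFun_cd
    refine hU'.inter (IsPolyFun.isZariskiClosed ?_)
    exact (((((ha.pow 2).mul (hd.pow 2)).add (((IsPolyFun.const 4).mul (ha.pow 3)).mul
      isPolyFun_cc)).add (((IsPolyFun.const 4).mul isPolyFun_cb).mul (hd.pow 3))).sub
      (((IsPolyFun.const 27).mul (isPolyFun_cb.pow 2)).mul (isPolyFun_cc.pow 2))).add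
      (((((IsPolyFun.const 18).mul ha).mul isPolyFun_cb).mul isPolyFun_cc).mul hd)
  | 3 =>
    change IsZariskiClosed tripleRoot
    rw [htriple]
    exact hU'.inter
      (((isPolyFun_ca.pow 2).add (isPolyFun_cb.mul isPolyFun_cd)).isZariskiClosed.inter
      (((isPolyFun_ca.mul isPolyFun_cd).sub (isPolyFun_cb.mul isPolyFun_cc)).isZariskiClosed.inter
      ((isPolyFun_cd.pow 2).add (isPolyFun_ca.mul isPolyFun_cc)).isZariskiClosed))
  | 4 => exact hline_closed
  | n + 5 =>
    change IsZariskiClosed {0}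
    rw [hzero]
    exact hline_closed.inter isPolyFun_cb.isZariskiClosed

lemma isPolyMap_lowerU {k : ℕ} (q : Fin 4 → MvPolynomial (Fin k) ℂ) :
    IsPolyMap fun y => lowerU (fun i => MvPolynomial.aeval y (q i)) 0 := by
  refine IsPolyMap.of_coords coords ![q 2, q 3, -q 0, -q 1, 0] fun y i => ?_
  fin_cases i <;> simp [coords_apply]

lemma lowerU_eq_of_mem_U' {u : U} (hu : u ∈ U') {s q r t : ℂ} (h : ∀ x, cubicForm u x =
    s * x 0 ^ 3 + q * x 0 ^ 2 * x 1 + r * x 0 * x 1 ^ 2 + t * x 1 ^ 3) {c : Fin 4 → ℂ}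
    (hc : ∀ i, c i = ![s, q / 3, r / 3, t] i) : lowerU c 0 = u :=
  U'_ext (lowerU_mem_U' _) hu fun x => by
    rw [h, cubicForm_lowerU]
    simp only [hc]
    simp
    ring

open MvPolynomial in
lemma idealOf_U'_isPrime : (idealOf (U' : Set U)).IsPrime := by
  have h : (U' : Set U) = Set.range fun y : Fin 4 → ℂ =>
      lowerU (fun i => aeval y (X i : MvPolynomial (Fin 4) ℂ)) 0 := by
    refine Set.Subset.antisymm (fun u hu => ⟨![-cc u, -cd u, ca u, cb u], ?_⟩) ?_
    · refine lowerU_eq_of_mem_U' hu (s := -cc u) (q := -3 * cd u) (r := 3 * ca u) (t := cb u)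
        (fun x => by rw [cubicForm_eq]; ring) fun i => ?_
      fin_cases i <;> simp
      ring
    · rintro _ ⟨y, rfl⟩
      exact lowerU_mem_U' _
  rw [h]
  exact (isPolyMap_lowerU _).idealOf_isPrime

-- The map `(l, m) ↦ l² m` is polynomial in four coefficients and surjects onto the locus, which
-- spares any factorization argument for the discriminant.
open MvPolynomial in
lemma idealOf_doubleRoot_isPrime : (idealOf doubleRoot).IsPrime := by
  have h : doubleRoot = Set.range fun y : Fin 4 → ℂ => lowerU (fun i => aeval y
      ((![X 0 ^ 2 * X 2, C (1 / 3) * (2 * X 0 * X 1 * X 2 + X 0 ^ 2 * X 3),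
        C (1 / 3) * (X 1 ^ 2 * X 2 + 2 * X 0 * X 1 * X 3), X 1 ^ 2 * X 3] :
          Fin 4 → MvPolynomial (Fin 4) ℂ) i)) 0 := by
    refine Set.Subset.antisymm ?_ ?_
    · rintro u ⟨hu, l, m, h⟩
      obtain ⟨l, rfl⟩ := exists_eq_linForm l
      obtain ⟨m, rfl⟩ := exists_eq_linForm m
      refine ⟨![l 0, l 1, m 0, m 1], ?_⟩
      refine lowerU_eq_of_mem_U' hu (s := l 0 ^ 2 * m 0)
        (q := 2 * l 0 * l 1 * m 0 + l 0 ^ 2 * m 1) (r := l 1 ^ 2 * m 0 + 2 * l 0 * l 1 * m 1)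
        (t := l 1 ^ 2 * m 1)
        (fun x => by rw [h]; simp only [linForm_apply]; ring) fun i => ?_
      fin_cases i <;> simp <;> ring
    · rintro _ ⟨y, rfl⟩
      refine ⟨lowerU_mem_U' _, linForm ![y 0, y 1], linForm ![y 2, y 3], fun x => ?_⟩
      rw [cubicForm_lowerU]
      simp
      ring
  rw [h]
  exact (isPolyMap_lowerU _).idealOf_isPrime

open MvPolynomial in
lemma idealOf_tripleRoot_isPrime : (idealOf tripleRoot).IsPrime := by
  have h : tripleRoot = Set.range fun y : Fin 3 → ℂ => lowerU (fun i => aeval y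
      ((![X 0 * X 1 ^ 3, X 0 * X 1 ^ 2 * X 2, X 0 * X 1 * X 2 ^ 2, X 0 * X 2 ^ 3] :
          Fin 4 → MvPolynomial (Fin 3) ℂ) i)) 0 := by
    refine Set.Subset.antisymm ?_ ?_
    · rintro u ⟨hu, r, l, h⟩
      obtain ⟨l, rfl⟩ := exists_eq_linForm l
      refine ⟨![r, l 0, l 1], ?_⟩
      refine lowerU_eq_of_mem_U' hu (s := r * l 0 ^ 3) (q := 3 * (r * l 0 ^ 2 * l 1))
        (r := 3 * (r * l 0 * l 1 ^ 2)) (t := r * l 1 ^ 3)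
        (fun x => by rw [h]; simp only [linForm_apply]; ring) fun i => ?_
      fin_cases i <;> simp
    · rintro _ ⟨y, rfl⟩
      refine ⟨lowerU_mem_U' _, y 0, linForm ![y 1, y 2], fun x => ?_⟩
      rw [cubicForm_lowerU]
      simp
      ring
  rw [h]
  exact (isPolyMap_lowerU _).idealOf_isPrime

open MvPolynomial in
lemma idealOf_cubeLine_isPrime : (idealOf cubeLine).IsPrime := by
  have h : cubeLine = Set.range fun y : Fin 1 → ℂ => lowerU (fun i => aeval y
      ((![0, 0, 0, X 0] : Fin 4 → MvPolynomial (Fin 1) ℂ) i)) 0 := by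
    refine Set.Subset.antisymm ?_ ?_
    · rintro u ⟨ha, hc, hd, he⟩
      exact ⟨![cb u], by apply ext_coords <;> simp [ha, hc, hd, he]⟩
    · rintro _ ⟨y, rfl⟩
      exact ⟨by simp, by simp, by simp, by simp⟩
  rw [h]
  exact (isPolyMap_lowerU _).idealOf_isPrime

lemma flag_isPrime (i : ℕ) : (idealOf (flag i)).IsPrime := by
  match i with
  | 0 =>
    have h : flag 0 = Set.range coords.symm := coords.symm.surjective.range_eq.symm
    rw [h]
    exact (IsPolyMap.of_coords coords MvPolynomial.X fun y i => by simp).idealOf_isPrime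
  | 1 => exact idealOf_U'_isPrime
  | 2 => exact idealOf_doubleRoot_isPrime
  | 3 => exact idealOf_tripleRoot_isPrime
  | 4 => exact idealOf_cubeLine_isPrime
  | n + 5 =>
    have h : flag (n + 5) = Set.range fun y : Fin 0 → ℂ => (0 : U) := by
      rw [Set.range_const]
      rfl
    rw [h]
    exact (IsPolyMap.of_coords coords 0 fun y i => by simp).idealOf_isPrime

lemma distinctRep_notMem : distinctRep ∉ doubleRoot := by
  rw [doubleRoot_eq_disc]
  rintro ⟨-, h⟩
  simp [distinctRep, discQuartic] at h

lemma doubleRep_mem : doubleRep ∈ doubleRoot :=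
  ⟨lowerU_mem_U' _, linForm ![1, 0], linForm ![0, 1], fun x => by
    rw [doubleRep, cubicForm_lowerU]
    simp⟩

lemma doubleRep_notMem : doubleRep ∉ tripleRoot := by
  rw [tripleRoot_eq_minors]
  rintro ⟨-, -, -, h⟩
  simp [doubleRep] at h

lemma tripleRep_mem : tripleRep ∈ tripleRoot :=
  ⟨lowerU_mem_U' _, 1, linForm ![1, 0], fun x => by
    rw [tripleRep, cubicForm_lowerU]
    simp⟩

lemma cc_zero : cc (0 : U) = 0 := by simp [cc, trilinear]

lemma tripleRep_ne_zero : tripleRep ≠ 0 := by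
  intro h
  have h1 := congrArg cc h
  simp [tripleRep, cc_zero] at h1

lemma lowerU_notMem_U' : lowerU 0 1 ∉ U' := by
  rw [mem_U'_iff, ce_lowerU]
  exact one_ne_zero

lemma cubeLine_subset : cubeLine ⊆ tripleRoot := by
  rw [tripleRoot_eq_minors]
  rintro u ⟨ha, hc, hd, he⟩
  exact ⟨(mem_U'_iff u).2 he, by simp [ha, hd], by simp [ha, hc], by simp [ha, hd]⟩

lemma zero_mem_cubeLine : (0 : U) ∈ cubeLine := by
  simp [cubeLine, ca, cc, cd, ce, trilinear]

lemma flag_ssubset (i : ℕ) (hi : i < 5) : flag (i + 1) ⊂ flag i := by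
  rw [Set.ssubset_iff_exists]
  interval_cases i
  · exact ⟨Set.subset_univ _, lowerU 0 1, Set.mem_univ _, lowerU_notMem_U'⟩
  · exact ⟨fun u hu => hu.1, distinctRep, lowerU_mem_U' _, distinctRep_notMem⟩
  · exact ⟨tripleRoot_subset, doubleRep, doubleRep_mem, doubleRep_notMem⟩
  · refine ⟨cubeLine_subset, tripleRep, tripleRep_mem, ?_⟩
    rintro ⟨-, h, -⟩
    simp [tripleRep] at h
  · refine ⟨Set.singleton_subset_iff.2 zero_mem_cubeLine, lowerU ![0, 0, 0, 1] 0, by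
      simp [flag, cubeLine], fun h => ?_⟩
    have h1 := congrArg cb (Set.mem_singleton_iff.1 h)
    rw [cb_lowerU] at h1
    simp [cb, trilinear] at h1

lemma codim_flag (i : ℕ) (hi : i ≤ 5) : codim (flag i) = i :=
  codim_of_flag finrank_U flag (fun i _ => flag_isPrime i) (fun i _ => flag_isZariskiClosed i)
    flag_ssubset i hi

/-! ### Identification of the orbits, their closures and codimensions -/

/-- The five orbits of `P` on `U`. -/
noncomputable def orbitOf : Fin 5 → Set U :=
  ![flag 0 \ flag 1, flag 1 \ flag 2, flag 2 \ flag 3, flag 3 \ flag 5, flag 5]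

/-- The position in the flag of the closure of each orbit. -/
def orbitCodim : Fin 5 → ℕ := ![0, 1, 2, 3, 5]

/-- Each orbit is dense in its flag member. Equality of ideals yields the closure and the
codimension at once. -/
lemma idealOf_orbitOf (i : Fin 5) : idealOf (orbitOf i) = idealOf (flag (orbitCodim i)) := by
  have h : ∀ i j, ¬flag i ⊆ flag j → idealOf (flag i \ flag j) = idealOf (flag i) := fun i j =>
    idealOf_diff (flag_isPrime i) (flag_isZariskiClosed j)
  fin_cases i
  · exact h 0 1 (flag_ssubset 0 (by norm_num)).2
  · exact h 1 2 (flag_ssubset 1 (by norm_num)).2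
  · exact h 2 3 (flag_ssubset 2 (by norm_num)).2
  · exact h 3 5 ((flag_ssubset 4 (by norm_num)).trans (flag_ssubset 3 (by norm_num))).2
  · rfl

lemma zariskiClosure_orbitOf (i : Fin 5) :
    zariskiClosure (orbitOf i) = flag (orbitCodim i) := by
  rw [zariskiClosure_eq_of_idealOf_eq (idealOf_orbitOf i)]
  exact flag_isZariskiClosed _

lemma flag_strictAnti {i j : ℕ} (hij : i < j) (hj : j ≤ 5) : flag j ⊂ flag i := by
  induction j, hij using Nat.le_induction with
  | base => exact flag_ssubset i (by omega)
  | succ j hij ih => exact (flag_ssubset j (by omega)).trans (ih (by omega))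

lemma strictAnti_zariskiClosure : StrictAnti fun i => zariskiClosure (orbitOf i) := by
  intro i j hij
  simp only [zariskiClosure_orbitOf]
  refine flag_strictAnti ?_ ?_
  · revert i j
    decide
  · revert j
    decide +revert

/-- Position 4 is excluded because `GL(E)` moves the line of cubics `b y³`; that line serves only
the codimension count. -/
lemma flag_invariant (i : ℕ) (hi : i ≠ 4) (g : P) : ∀ u ∈ flag i, AdU g u ∈ flag i := by
  match i with
  | 0 => exact fun u _ => Set.mem_univ _
  | 1 => exact AdU_mem_U' g
  | 2 => exact AdU_mem_doubleRoot g
  | 3 => exact AdU_mem_tripleRoot g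
  | 4 => exact absurd rfl hi
  | n + 5 =>
    rintro _ rfl
    exact map_zero _

lemma orbit_eq_orbitOf {i : Fin 5} {u : U} (hu : u ∈ orbitOf i) : orbit u = orbitOf i := by
  fin_cases i
  · exact orbit_eq_of_invariant (invariant_diff (flag_invariant 0 (by norm_num))
      (flag_invariant 1 (by norm_num))) generic_subset_orbit hu
  · exact orbit_eq_of_invariant (invariant_diff (flag_invariant 1 (by norm_num))
      (flag_invariant 2 (by norm_num))) distinct_subset_orbit hu
  · exact orbit_eq_of_invariant (invariant_diff (flag_invariant 2 (by norm_num))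
      (flag_invariant 3 (by norm_num))) double_subset_orbit hu
  · exact orbit_eq_of_invariant (invariant_diff (flag_invariant 3 (by norm_num))
      (flag_invariant 5 (by norm_num))) triple_subset_orbit hu
  · exact orbit_eq_of_invariant (flag_invariant 5 (by norm_num))
      (Set.singleton_subset_iff.2 ⟨1, map_zero (AdU 1)⟩) hu

lemma orbitOf_nonempty (i : Fin 5) : (orbitOf i).Nonempty := by
  fin_cases i
  · exact ⟨lowerU 0 1, Set.mem_univ _, lowerU_notMem_U'⟩
  · exact ⟨distinctRep, lowerU_mem_U' _, distinctRep_notMem⟩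
  · exact ⟨doubleRep, doubleRep_mem, doubleRep_notMem⟩
  · exact ⟨tripleRep, tripleRep_mem, tripleRep_ne_zero⟩
  · exact ⟨0, rfl⟩

lemma exists_mem_orbitOf (u : U) : ∃ i, u ∈ orbitOf i := by
  by_cases h1 : u ∈ flag 1
  · by_cases h2 : u ∈ flag 2
    · by_cases h3 : u ∈ flag 3
      · by_cases h5 : u ∈ flag 5
        · exact ⟨4, h5⟩
        · exact ⟨3, h3, h5⟩
      · exact ⟨2, h2, h3⟩
    · exact ⟨1, h1, h2⟩
  · exact ⟨0, Set.mem_univ _, h1⟩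

lemma range_orbitOf : Set.range orbitOf = orbits := by
  refine Set.Subset.antisymm ?_ ?_
  · rintro _ ⟨i, rfl⟩
    obtain ⟨u, hu⟩ := orbitOf_nonempty i
    exact ⟨u, orbit_eq_orbitOf hu⟩
  · rintro _ ⟨u, rfl⟩
    obtain ⟨i, hi⟩ := exists_mem_orbitOf u
    exact ⟨i, (orbit_eq_orbitOf hi).symm⟩

end TrialityG2

theorem proposition5p1 :
    -- `P` is the maximal parabolic omitting the long simple root: `𝔭 = 𝔟 ⊕ 𝔤_{-α₁}`
    p =
      weightSpace 0 0 ⊔ weightSpace 1 0 ⊔ weightSpace 0 1 ⊔ weightSpace 1 1 ⊔ weightSpace 2 1 ⊔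
        weightSpace 3 1 ⊔ weightSpace 3 2 ⊔ weightSpace (-1) 0 ∧
    -- `U = 𝔤₂/𝔭` is the space `(Sym³ E* ⊗ ⋀² E) ⊕ ⋀² E*` of triality-symmetric maps
    Function.Injective phi ∧
    (∀ φ, φ ∈ LinearMap.range phi ↔ IsTrialitySymmetric φ) ∧
    -- the cubic form of `u ∈ U'` in the coordinates `a, b, c, d`
    (∀ u ∈ U', ∀ x y : ℂ, cubicForm u ![x, y] =
      -cc u * x ^ 3 - 3 * cd u * x ^ 2 * y + 3 * ca u * x * y ^ 2 + cb u * y ^ 3) ∧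
    -- the orbits
    ∃ O : Fin 5 → Set U,
      Function.Injective O ∧ Set.range O = orbits ∧
      (∀ i, codim (O i) = (![0, 1, 2, 3, 5] i : ℕ)) ∧
      StrictAnti (fun i => zariskiClosure (O i)) ∧
      zariskiClosure (O 0) = Set.univ ∧
      zariskiClosure (O 1) = (U' : Set U) ∧
      zariskiClosure (O 2) =
        {u | u ∈ U' ∧ discQuartic (3 * ca u) (cb u) (cc u) (3 * cd u) = 0} ∧
      zariskiClosure (O 2) =
        {u | u ∈ U' ∧ ∃ l m : E →ₗ[ℂ] ℂ, ∀ x, cubicForm u x = l x ^ 2 * m x} ∧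
      zariskiClosure (O 3) =
        {u | u ∈ U' ∧ (!![ca u, -cd u, cc u; cb u, ca u, cd u]).rank ≤ 1} ∧
      zariskiClosure (O 3) =
        {u | u ∈ U' ∧ ∃ r s t : ℂ, cb u = r * s ^ 3 ∧ ca u = r * (s ^ 2 * t) ∧
          -cd u = r * (s * t ^ 2) ∧ -cc u = r * t ^ 3} ∧
      zariskiClosure (O 4) = O 4 ∧ O 4 = {0} := by
  refine ⟨p_eq_sup_weightSpace, phi_injective, range_phi, fun u _ x y => ?_, orbitOf, ?_,
    range_orbitOf, fun i => ?_, strictAnti_zariskiClosure, zariskiClosure_orbitOf 0,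
    zariskiClosure_orbitOf 1, (zariskiClosure_orbitOf 2).trans doubleRoot_eq_disc,
    zariskiClosure_orbitOf 2, (zariskiClosure_orbitOf 3).trans tripleRoot_eq_rank,
    (zariskiClosure_orbitOf 3).trans tripleRoot_eq_param, zariskiClosure_orbitOf 4, rfl⟩
  · rw [cubicForm_eq]
    simp
  · exact fun i j h => strictAnti_zariskiClosure.injective (congrArg zariskiClosure h)
  · rw [codim, idealOf_orbitOf]
    exact codim_flag (orbitCodim i) (by fin_cases i <;> decide)
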